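/- All graphs are finite and simple. A graph is planar if it can be drawn in the plane (vertices as distinct points, edges as simple arcs joining their ends) so that no edge passes through a vertex other than its ends and two edges meet only at common endpoints. Write $\rho(G)$ for the spectral radius of the adjacency matrix of $G$, $G\cup H$ for the disjoint union, $tK_1$ for the graph with $t$ vertices and no edges, $S_k$ for the star with $k$ edges (on $k+1$ vertices), and $G\vee H$ for the join, obtained from $G\cup H$ by adding all edges between $G$ and $H$. For an integer $m\ge 2$ put $$G_m=\begin{cases}K_2\vee \frac{m-1}{2}K_1, & m \text{ odd},\\[2pt] K_1\vee\bigl(S_{\frac{m-2}{2}}\cup K_1\bigr), & m\text{ even}.\end{cases}$$ **Theorem.** There is an integer $M$ such that for every $m\ge M$ and every planar graph $G$ with exactly $m$ edges, $\rho(G)\le\rho(G_m)$. Moreover, if $G$ has no isolated vertices, then $\rho(G)=\rho(G_m)$ if and only if $G\cong G_m$. -/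

import Mathlib

/-- The spectral radius of a finite graph, i.e. the spectral radius of its adjacency matrix. The
matrix is real symmetric, so all its (complex) eigenvalues are real and it is enough to take the
real spectrum. It is a finite number in `[0, ∞]`. -/
noncomputable def graphSpectralRadius {V : Type*} [Fintype V] (G : SimpleGraph V) : ENNReal := by
  classical exact spectralRadius ℝ (G.adjMatrix ℝ)

/-- `A` is a (simple) arc in the Euclidean plane with endpoints `p` and `q`: the image of an
injective continuous map on `[0, 1]` that starts at `p` and ends at `q`. -/
def IsPlaneArc (A : Set (EuclideanSpace ℝ (Fin 2))) (p q : EuclideanSpace ℝ (Fin 2)) : Prop :=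
  ∃ γ : Path p q, Function.Injective γ ∧ Set.range γ = A

/-- A drawing of `G` in the plane in which edges meet only at common endpoints. The value of `arc`
at a pair that is not an edge is irrelevant. -/
structure PlaneDrawing {V : Type*} (G : SimpleGraph V) where
  /-- the point that represents a vertex -/
  point : V → EuclideanSpace ℝ (Fin 2)
  /-- the curve that represents an edge -/
  arc : Sym2 V → Set (EuclideanSpace ℝ (Fin 2))
  /-- distinct vertices are distinct points -/
  point_injective : Function.Injective point
  /-- an edge is an arc between its two ends -/
  isPlaneArc : ∀ u v, G.Adj u v → IsPlaneArc (arc s(u, v)) (point u) (point v)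
  /-- an edge passes through no vertex other than its ends -/
  mem_of_point_mem_arc : ∀ e ∈ G.edgeSet, ∀ w, point w ∈ arc e → w ∈ e
  /-- two different edges meet only in common ends -/
  arc_inter_arc : ∀ e ∈ G.edgeSet, ∀ f ∈ G.edgeSet, e ≠ f →
    arc e ∩ arc f ⊆ point '' {w | w ∈ e ∧ w ∈ f}

/-- A graph is planar if it has a drawing in the plane without crossings. -/
def IsPlanarGraph {V : Type*} (G : SimpleGraph V) : Prop :=
  Nonempty (PlaneDrawing G)

/-- The join `G ∨ H`: the disjoint union of `G` and `H` together with all edges between them. -/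
def graphJoin {V W : Type*} (G : SimpleGraph V) (H : SimpleGraph W) : SimpleGraph (V ⊕ W) :=
  (G ⊕g H) ⊔ completeBipartiteGraph V W

/-- The star `S_k` with `k` edges, on `k + 1` vertices. -/
def starWithEdges (k : ℕ) : SimpleGraph (Fin (k + 1)) :=
  SimpleGraph.starGraph 0

/-- The graph `K₂ ∨ ((m - 1) / 2) K₁`, which has `m` edges when `m` is odd. -/
def extremalGraphOdd (m : ℕ) : SimpleGraph (Fin 2 ⊕ Fin ((m - 1) / 2)) :=
  graphJoin (⊤ : SimpleGraph (Fin 2)) (⊥ : SimpleGraph (Fin ((m - 1) / 2)))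

/-- The graph `K₁ ∨ (S_{(m - 2) / 2} ∪ K₁)`, which has `m` edges when `m ≥ 2` is even. -/
def extremalGraphEven (m : ℕ) : SimpleGraph (Fin 1 ⊕ (Fin ((m - 2) / 2 + 1) ⊕ Fin 1)) :=
  graphJoin (⊤ : SimpleGraph (Fin 1))
    (starWithEdges ((m - 2) / 2) ⊕g (⊤ : SimpleGraph (Fin 1)))

/-! Planarity enters only through the absence of `K₃,₃`, which is proved by a parity count of
winding numbers. The rest is spectral.

The extremal graphs are two adjacent vertices `u`, `v` with `a` common neighbours and `b ≤ 1` leaves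
at `u`, so `m = 1 + 2a + b`. A test vector shows that they satisfy `m - ρ² + ρ ≤ 1 + b/2`
(`IsBookWithLeaves.le_sq_sub`). A competitor with at least this radius therefore has deficit `m - ρ²
+ ρ` at most `1` or `3/2`.

Scale a Perron vector `x` of the competitor so that its largest entry is `x u = 1`. The equation for
walks of length two, together with the absence of `K₃,₃`, makes every entry outside a bounded set of
high-degree vertices small. Hence at most one vertex `v ≠ u` has an entry above `1/2`, and it shares
at least `4m/10` neighbours with `u` (`NoThreeThree.codegree_of_entry_large`). Such a `v` exists
next to `u` because `ρ² > m` (`IsPerronVector.exists_adj_entry_large`).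

The deficit is a sum of local contributions (`IsPerronVector.deficit_eq`). The pair `u`, `v` and its
common neighbours already account for `1`, and each edge that does not fit the pattern costs more
than the remaining `1/2`. So only the pattern survives, with some number `b` of leaves. The deficit
bound gives `b ≤ 2`, and parity of `m` (with the sharper bound `1` when `m` is odd) fixes `b`.
Isolated vertices are removed at the end by passing to the support. -/

/-! ### Plane topology: a plane drawing contains no `K₃,₃`. -/

theorem exists_continuous_log {X : Type*} [TopologicalSpace X] [SimplyConnectedSpace X]
    [LocallyPathConnectedSpace X] (f : C(X, ℂ)) (hf : ∀ x, f x ≠ 0) :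
    ∃ g : C(X, ℂ), ∀ x, Complex.exp (g x) = f x := by
  obtain ⟨x₀⟩ : Nonempty X := inferInstance
  obtain ⟨F, ⟨-, hF⟩, -⟩ := Complex.isCoveringMapOn_exp.existsUnique_continuousMap_lifts f
    (a₀ := x₀) (e₀ := Complex.log (f x₀)) (Complex.exp_log (hf x₀)) (fun a => hf a)
  exact ⟨F, fun x => congrFun hF x⟩

/-- Two values of `d` differ by an integer multiple of `2πi`, and a continuous integer-valued
function on the line is constant. -/
theorem eq_of_exp_eq_const {d : ℝ → ℂ} (hd : Continuous d) {c : ℂ}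
    (h : ∀ t, Complex.exp (d t) = c) (s t : ℝ) : d s = d t := by
  have key : ∀ t, ∃ n : ℤ, d t = d 0 + n * (2 * Real.pi * Complex.I) := fun t =>
    Complex.exp_eq_exp_iff_exists_int.1 ((h t).trans (h 0).symm)
  choose n hn using key
  have hpi : (2 * Real.pi * Complex.I : ℂ) ≠ 0 := Complex.two_pi_I_ne_zero
  have hcont : Continuous fun t => ((n t : ℤ) : ℂ) := by
    have : (fun t => ((n t : ℤ) : ℂ)) = fun t => (d t - d 0) / (2 * Real.pi * Complex.I) := by
      funext t
      rw [hn t]; field_simp; ring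
    rw [this]; fun_prop
  have hcont' : Continuous n := by
    have h2 : Continuous fun t => ((n t : ℤ) : ℝ) := by
      simpa [Function.comp_def] using Complex.continuous_re.comp hcont
    exact Int.isClosedEmbedding_coe_real.isEmbedding.continuous_iff.2 h2
  have := PreconnectedSpace.constant (inferInstance : PreconnectedSpace ℝ) hcont' (x := s) (y := t)
  rw [hn s, hn t, this]

/-- The increment of a continuous logarithm of a nonvanishing curve is determined by the curve, even
up to a constant factor; it differs from a given difference of logarithms by a multiple of `2πi`. -/
theorem exists_int_log_increment {f : ℝ → ℂ} (hf : Continuous f) (h0 : ∀ t, f t ≠ 0) {p q : ℂ}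
    (hp : Complex.exp p = f 0) (hq : Complex.exp q = f 1) :
    ∃ n : ℤ, ∀ (g : ℝ → ℂ) (c : ℂ), Continuous g → (∀ t, Complex.exp (g t) = c * f t) →
      g 1 - g 0 = n * (2 * Real.pi * Complex.I) + q - p := by
  obtain ⟨l, hl⟩ := exists_continuous_log ⟨f, hf⟩ h0
  replace hl : ∀ t, Complex.exp (l t) = f t := hl
  obtain ⟨n₀, hn₀⟩ := Complex.exp_eq_exp_iff_exists_int.1 ((hl 0).trans hp.symm)
  obtain ⟨n₁, hn₁⟩ := Complex.exp_eq_exp_iff_exists_int.1 ((hl 1).trans hq.symm)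
  refine ⟨n₁ - n₀, fun g c hg hgc => ?_⟩
  have := eq_of_exp_eq_const (d := fun t => g t - l t) (c := c) (by fun_prop)
    (fun t => by rw [Complex.exp_sub, hgc, hl, mul_div_cancel_right₀ _ (h0 t)]) 1 0
  push_cast
  linear_combination this + hn₁ - hn₀

/-- There is no drawing of `K₃,₃` in which edges without common end are disjoint. -/
theorem no_drawing_completeBipartite_three_three (a b : Fin 3 → ℂ) (γ : Fin 3 → Fin 3 → ℝ → ℂ)
    (hγ : ∀ i j, Continuous (γ i j)) (h0 : ∀ i j, γ i j 0 = a i) (h1 : ∀ i j, γ i j 1 = b j)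
    (hdisj : ∀ i j k l, i ≠ k → j ≠ l → ∀ s t, γ i j s ≠ γ k l t) : False := by
  have other : ∀ i : Fin 3, ∃ j, i ≠ j := by decide
  have hca : ∀ k i j, i ≠ k → ∀ t, γ i j t - a k ≠ 0 := fun k i j hik t => by
    obtain ⟨l, hl⟩ := other j
    rw [← h0 k l]; exact sub_ne_zero.2 (hdisj _ _ _ _ hik hl _ _)
  have hcb : ∀ l i j, j ≠ l → ∀ t, γ i j t - b l ≠ 0 := fun l i j hjl t => by
    obtain ⟨k, hk⟩ := other i
    rw [← h1 k l]; exact sub_ne_zero.2 (hdisj _ _ _ _ hk hjl _ _)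
  have hab : ∀ i j, a i - b j ≠ 0 := fun i j => by
    obtain ⟨l, hl⟩ := other j
    rw [← h0 i l]; exact hcb _ _ _ hl.symm _
  have haa : ∀ i k, i ≠ k → a i - a k ≠ 0 := fun i k hik => by
    rw [← h0 i 0]; exact hca _ _ _ hik _
  have hbb : ∀ i k, i ≠ k → b i - b k ≠ 0 := fun i k hik => by
    rw [← h1 0 i]; exact hcb _ _ _ hik _
  -- Reference logarithms of the differences, normalised so that reversing a difference adds exactly
  -- `πi`; these half turns produce the `-1` in `square`.
  have hlog : ∀ c : Fin 3 → ℂ, (∀ i k, i ≠ k → c i - c k ≠ 0) → ∃ A : Fin 3 → Fin 3 → ℂ,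
      (∀ i k, i ≠ k → Complex.exp (A i k) = c i - c k) ∧
      ∀ i k, i < k → A k i = A i k + Real.pi * Complex.I := by
    intro c hc
    refine ⟨fun i k => if i < k then Complex.log (c i - c k) else
      Complex.log (c k - c i) + Real.pi * Complex.I, fun i k hik => ?_, fun i k hik => ?_⟩
    · by_cases h : i < k
      · simp only [h, if_true]; exact Complex.exp_log (hc _ _ hik)
      · simp only [h, if_false]
        rw [Complex.exp_add, Complex.exp_pi_mul_I, Complex.exp_log (hc _ _ hik.symm)]; ring
    · simp [hik, hik.not_gt]
  obtain ⟨AA, hAA, hAA'⟩ := hlog a haa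
  obtain ⟨BB, hBB, hBB'⟩ := hlog b hbb
  set AB : Fin 3 → Fin 3 → ℂ := fun i j => Complex.log (a i - b j) with hABdef
  have hAB : ∀ i j, Complex.exp (AB i j) = a i - b j := fun i j => Complex.exp_log (hab i j)
  have hBA : ∀ i j, Complex.exp (AB i j + Real.pi * Complex.I) = b j - a i := fun i j => by
    rw [Complex.exp_add, Complex.exp_pi_mul_I, hAB]; ring
  have hna : ∀ k i j, ∃ n : ℤ, i ≠ k → ∀ (g : ℝ → ℂ) (c : ℂ), Continuous g →
      (∀ t, Complex.exp (g t) = c * (γ i j t - a k)) →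
      g 1 - g 0 = n * (2 * Real.pi * Complex.I) + (AB k j + Real.pi * Complex.I) - AA i k := by
    intro k i j
    by_cases hik : i = k
    · exact ⟨0, fun h => absurd hik h⟩
    obtain ⟨n, hn⟩ := exists_int_log_increment (f := fun t => γ i j t - a k)
      ((hγ i j).sub continuous_const) (hca k i j hik) (p := AA i k)
      (q := AB k j + Real.pi * Complex.I) (by simp [hAA i k hik, h0]) (by simp only [hBA, h1])
    exact ⟨n, fun _ => hn⟩
  have hnb : ∀ l i j, ∃ n : ℤ, j ≠ l → ∀ (g : ℝ → ℂ) (c : ℂ), Continuous g →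
      (∀ t, Complex.exp (g t) = c * (γ i j t - b l)) →
      g 1 - g 0 = n * (2 * Real.pi * Complex.I) + BB j l - AB i l := by
    intro l i j
    by_cases hjl : j = l
    · exact ⟨0, fun h => absurd hjl h⟩
    obtain ⟨n, hn⟩ := exists_int_log_increment (f := fun t => γ i j t - b l)
      ((hγ i j).sub continuous_const) (hcb l i j hjl) (p := AB i l)
      (q := BB j l) (by simp only [hAB, h0]) (by simp only [hBB j l hjl, h1])
    exact ⟨n, fun _ => hn⟩
  choose na hna using hna
  choose nb hnb using hnb
  have hpi : (Real.pi * Complex.I : ℂ) ≠ 0 := by simp [Real.pi_ne_zero]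
  -- The difference of two edges without common end is a nonvanishing function on the plane of
  -- parameters, so it has a continuous logarithm there. Its increments around the unit square
  -- cancel, and each side is measured by one of the integers `na`, `nb`.
  have square : ∀ i j k l, i < k → j ≠ l →
      na k i j + nb j k l - nb l i j - na i k l = if j < l then -1 else 0 := by
    intro i j k l hik hjl
    obtain ⟨g, hg⟩ := exists_continuous_log
      (⟨fun p : ℝ × ℝ => γ i j p.1 - γ k l p.2, by fun_prop⟩ : C(ℝ × ℝ, ℂ))
      (fun p => sub_ne_zero.2 (hdisj _ _ _ _ hik.ne hjl _ _))
    replace hg : ∀ p : ℝ × ℝ, Complex.exp (g p) = γ i j p.1 - γ k l p.2 := hg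
    have e1 := hna k i j hik.ne (fun t => g (t, 0)) 1 (by fun_prop) (fun t => by
      rw [hg]; simp [h0])
    have e2 := hnb j k l hjl.symm (fun t => g (1, t)) (-1) (by fun_prop) (fun t => by
      rw [hg]; simp [h1])
    have e3 := hnb l i j hjl (fun t => g (t, 1)) 1 (by fun_prop) (fun t => by
      rw [hg]; simp [h1])
    have e4 := hna i k l hik.ne' (fun t => g (0, t)) (-1) (by fun_prop) (fun t => by
      rw [hg]; simp [h0])
    have eA := hAA' i k hik
    split_ifs with h
    · have eB := hBB' j l h
      have : ((na k i j + nb j k l - nb l i j - na i k l : ℤ) : ℂ) * (2 * (Real.pi * Complex.I)) =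
          ((-1 : ℤ) : ℂ) * (2 * (Real.pi * Complex.I)) := by
        push_cast
        linear_combination e3 + e4 - e1 - e2 - eA - eB
      exact_mod_cast mul_right_cancel₀ (mul_ne_zero two_ne_zero hpi) this
    · have eB := hBB' l j (lt_of_le_of_ne (not_lt.1 h) hjl.symm)
      have : ((na k i j + nb j k l - nb l i j - na i k l : ℤ) : ℂ) * (2 * (Real.pi * Complex.I)) =
          ((0 : ℤ) : ℂ) * (2 * (Real.pi * Complex.I)) := by
        push_cast
        linear_combination e3 + e4 - e1 - e2 - eA + eB
      exact_mod_cast mul_right_cancel₀ (mul_ne_zero two_ne_zero hpi) this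
  have s : ∀ i k : Fin 3, i < k → _ := fun i k h => And.intro (square i 0 k 1 h (by decide))
    (And.intro (square i 0 k 2 h (by decide)) (And.intro (square i 1 k 2 h (by decide))
    (And.intro (square i 1 k 0 h (by decide)) (And.intro (square i 2 k 0 h (by decide))
      (square i 2 k 1 h (by decide))))))
  have s01 := s 0 1 (by decide)
  have s02 := s 0 2 (by decide)
  have s12 := s 1 2 (by decide)
  simp only [show (0 : Fin 3) < 1 by decide, show (0 : Fin 3) < 2 by decide,
    show (1 : Fin 3) < 2 by decide, show ¬ (1 : Fin 3) < 0 by decide,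
    show ¬ (2 : Fin 3) < 0 by decide, show ¬ (2 : Fin 3) < 1 by decide, if_true, if_false]
    at s01 s02 s12
  -- Parity of the 18 relations: every integer `na`, `nb` occurs in exactly two of them with
  -- coefficient `±1`, so the left sides add up to an even number, while the right sides add up to
  -- `-9`.
  omega

theorem PlaneDrawing.no_three_three {V : Type*} {G : SimpleGraph V} (D : PlaneDrawing G)
    (a b : Fin 3 → V) (ha : Function.Injective a) (hb : Function.Injective b)
    (hab : ∀ i j, G.Adj (a i) (b j)) : False := by
  choose γ hγi hγr using fun i j => D.isPlaneArc _ _ (hab i j)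
  let φ : EuclideanSpace ℝ (Fin 2) → ℂ := fun p => ⟨p 0, p 1⟩
  have hφ : Function.Injective φ := fun p q h => by
    have h0 := congrArg Complex.re h
    have h1 := congrArg Complex.im h
    ext i; fin_cases i
    · exact h0
    · exact h1
  have hφc : Continuous φ := by
    have : φ = fun p => (p 0 : ℂ) + (p 1 : ℂ) * Complex.I := by
      funext p; exact Complex.mk_eq_add_mul_I _ _
    rw [this]; fun_prop
  refine no_drawing_completeBipartite_three_three (fun i => φ (D.point (a i)))
    (fun j => φ (D.point (b j))) (fun i j t => φ ((γ i j).extend t))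
    (fun i j => hφc.comp (γ i j).continuous_extend) (by simp) (by simp) ?_
  intro i j k l hik hjl s t heq
  have heq := hφ heq
  have hmem : ∀ i j t, (γ i j).extend t ∈ D.arc s(a i, b j) := fun i j t => by
    rw [← hγr i j, ← (γ i j).extend_range]; exact ⟨t, rfl⟩
  have hne : s(a i, b j) ≠ s(a k, b l) := by
    intro h
    rcases Sym2.eq_iff.1 h with ⟨h1, -⟩ | ⟨h1, -⟩
    · exact hik (ha h1)
    · exact (hab i l).ne h1
  obtain ⟨w, ⟨hw1, hw2⟩, -⟩ := D.arc_inter_arc _ (hab i j) _ (hab k l) hne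
    ⟨hmem i j s, heq ▸ hmem k l t⟩
  rcases Sym2.mem_iff.1 hw1 with rfl | rfl <;> rcases Sym2.mem_iff.1 hw2 with h | h
  · exact hik (ha h)
  · exact (hab i l).ne h
  · exact (hab k j).ne h.symm
  · exact hjl (hb h)

/-! ### The adjacency form, its Perron vector and the spectral radius. -/

open Classical in
/-- The entries of the adjacency matrix as a real-valued function. -/
noncomputable def SimpleGraph.adjFun {V : Type*} (G : SimpleGraph V) (v w : V) : ℝ :=
  if G.Adj v w then 1 else 0

namespace SimpleGraph

variable {V : Type*} (G : SimpleGraph V)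

theorem adjFun_of_adj {v w : V} (h : G.Adj v w) : G.adjFun v w = 1 := if_pos h

theorem adjFun_of_not_adj {v w : V} (h : ¬ G.Adj v w) : G.adjFun v w = 0 := if_neg h

theorem adjFun_comm (v w : V) : G.adjFun v w = G.adjFun w v := by
  by_cases h : G.Adj v w
  · rw [G.adjFun_of_adj h, G.adjFun_of_adj h.symm]
  · rw [G.adjFun_of_not_adj h, G.adjFun_of_not_adj (fun h' => h h'.symm)]

@[simp] theorem adjFun_self (v : V) : G.adjFun v v = 0 := by simp [adjFun]

theorem adjFun_nonneg (v w : V) : 0 ≤ G.adjFun v w := by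
  unfold adjFun; split_ifs <;> norm_num

theorem adjFun_le_one (v w : V) : G.adjFun v w ≤ 1 := by
  unfold adjFun; split_ifs <;> norm_num

theorem adjFun_mul_self (v w : V) : G.adjFun v w * G.adjFun v w = G.adjFun v w := by
  unfold adjFun; split_ifs <;> norm_num

theorem adjFun_eq_zero_or_one (v w : V) : G.adjFun v w = 0 ∨ G.adjFun v w = 1 := by
  unfold adjFun; split_ifs <;> simp

end SimpleGraph

open SimpleGraph Finset

theorem eq_zero_of_forall_quadratic_nonneg {a b : ℝ} (h : ∀ t : ℝ, 0 ≤ t * a + t ^ 2 * b) :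
    a = 0 := by
  have hb : 0 < |b| + 1 := by positivity
  -- A small step against the sign of `a`; the denominator is positive and exceeds `b`, so the
  -- linear term wins.
  have h1 := h (-a / (|b| + 1))
  have h2 : (-a / (|b| + 1)) * a + (-a / (|b| + 1)) ^ 2 * b =
      -(a ^ 2 * (|b| + 1 - b)) / (|b| + 1) ^ 2 := by
    field_simp; ring
  rw [h2, neg_div] at h1
  have h3 : 0 < |b| + 1 - b := by linarith [le_abs_self b]
  by_contra ha
  have : 0 < a ^ 2 * (|b| + 1 - b) / (|b| + 1) ^ 2 := by positivity
  linarith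

/-- A nonnegative eigenvector for the largest eigenvalue of the adjacency matrix, and the
variational bound. -/
theorem exists_perron_vector {V : Type*} [Fintype V] [Nonempty V] (G : SimpleGraph V) :
    ∃ (ρ : ℝ) (x : V → ℝ), (∀ v, 0 ≤ x v) ∧ (∃ v, x v ≠ 0) ∧
      (∀ v, ρ * x v = ∑ w, G.adjFun v w * x w) ∧
      ∀ y : V → ℝ, ∑ v, ∑ w, G.adjFun v w * (y v * y w) ≤ ρ * ∑ v, y v ^ 2 := by
  classical
  set q : (V → ℝ) → ℝ := fun y => ∑ v, ∑ w, G.adjFun v w * (y v * y w) with hq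
  set S : Set (V → ℝ) := {y | ∑ v, y v ^ 2 = 1} with hS
  have hScomp : IsCompact S := by
    refine IsCompact.of_isClosed_subset (isCompact_univ_pi fun _ : V => isCompact_Icc (a := (-1 : ℝ)) (b := 1))
      (isClosed_eq (by fun_prop) continuous_const) ?_
    intro y hy v _
    have : y v ^ 2 ≤ 1 := by
      rw [← (show ∑ v, y v ^ 2 = 1 from hy)]
      exact single_le_sum (f := fun v => y v ^ 2) (fun i _ => sq_nonneg _) (mem_univ v)
    exact abs_le.1 ((sq_le_one_iff_abs_le_one _).1 this)
  have hSne : S.Nonempty := by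
    obtain ⟨v⟩ := (inferInstance : Nonempty V)
    refine ⟨Pi.single v 1, ?_⟩
    simp [hS, Pi.single_apply, ite_pow]
  obtain ⟨x₀, hx₀, hmax⟩ := hScomp.exists_isMaxOn hSne
    (show ContinuousOn q S from Continuous.continuousOn (by fun_prop))
  -- Absolute values keep the norm and do not decrease the form, so the maximiser may be taken
  -- nonnegative.
  set x : V → ℝ := fun v => |x₀ v|
  have hxS : ∑ v, x v ^ 2 = 1 := by
    simp only [x, sq_abs]; exact hx₀
  have hqx : q x₀ ≤ q x := by
    refine sum_le_sum fun v _ => sum_le_sum fun w _ => ?_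
    refine mul_le_mul_of_nonneg_left ?_ (G.adjFun_nonneg v w)
    rw [← abs_mul]; exact le_abs_self _
  have hray : ∀ y : V → ℝ, q y ≤ q x * ∑ v, y v ^ 2 := by
    intro y
    set n := ∑ v, y v ^ 2 with hn
    have hn0 : 0 ≤ n := sum_nonneg fun _ _ => sq_nonneg _
    rcases hn0.eq_or_lt with h0 | hpos
    · have : ∀ v, y v = 0 := fun v => by
        have := (sum_eq_zero_iff_of_nonneg (fun i _ => sq_nonneg (y i))).1 h0.symm v (mem_univ v)
        exact pow_eq_zero_iff (two_ne_zero) |>.1 this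
      rw [← h0]; simp [hq, this]
    · have hs : (fun v => y v / √n) ∈ S := by
        simp only [hS, Set.mem_ofPred_eq, div_pow, Real.sq_sqrt hn0, ← sum_div]
        exact div_self hpos.ne'
      have h1 := (hmax hs).trans hqx
      have h2 : q (fun v => y v / √n) = q y / n := by
        simp only [hq, sum_div]
        refine sum_congr rfl fun v _ => sum_congr rfl fun w _ => ?_
        rw [div_mul_div_comm, Real.mul_self_sqrt hn0, ← mul_div_assoc]
      have h1 : q y / n ≤ q x := h2 ▸ h1
      rwa [div_le_iff₀ hpos] at h1
  refine ⟨q x, x, fun v => abs_nonneg _, ?_, fun v => ?_, hray⟩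
  · by_contra! h
    simp [h] at hxS
  -- The eigenvalue equation at `v` is the vanishing of the first variation in the direction of the
  -- coordinate `v`.
  · have hexp : ∀ t : ℝ, q (fun w => x w + t * (Pi.single v 1 : V → ℝ) w) =
        q x + t * (2 * ∑ w, G.adjFun v w * x w) := by
      intro t
      have h1 : ∀ a b, G.adjFun a b * ((x a + t * (Pi.single v 1 : V → ℝ) a) *
          (x b + t * (Pi.single v 1 : V → ℝ) b)) = G.adjFun a b * (x a * x b) +
          t * ((Pi.single v 1 : V → ℝ) b * (G.adjFun a b * x a)) +
          t * ((Pi.single v 1 : V → ℝ) a * (G.adjFun a b * x b)) +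
          t ^ 2 * ((Pi.single v 1 : V → ℝ) a * ((Pi.single v 1 : V → ℝ) b * G.adjFun a b)) := by
        intro a b; ring
      simp only [hq, h1, sum_add_distrib, ← mul_sum]
      simp only [Pi.single_apply, ite_mul, one_mul, zero_mul, sum_ite_eq', mem_univ, if_true,
        adjFun_self, mul_zero, add_zero]
      have h2 : ∑ a, G.adjFun a v * x a = ∑ w, G.adjFun v w * x w :=
        sum_congr rfl fun a _ => by rw [G.adjFun_comm]
      rw [h2]; ring
    have hexp2 : ∀ t : ℝ, ∑ w, (x w + t * (Pi.single v 1 : V → ℝ) w) ^ 2 =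
        1 + t * (2 * x v) + t ^ 2 := by
      intro t
      have h1 : ∀ w, (x w + t * (Pi.single v 1 : V → ℝ) w) ^ 2 = x w ^ 2 +
          t * 2 * ((Pi.single v 1 : V → ℝ) w * x w) +
          t ^ 2 * ((Pi.single v 1 : V → ℝ) w * (Pi.single v 1 : V → ℝ) w) := by intro w; ring
      simp only [h1, sum_add_distrib, ← mul_sum, hxS]
      simp [Pi.single_apply]; ring
    have := eq_zero_of_forall_quadratic_nonneg
      (a := 2 * (q x * x v - ∑ w, G.adjFun v w * x w)) (b := q x) (fun t => by
        have := hray (fun w => x w + t * (Pi.single v 1 : V → ℝ) w)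
        rw [hexp, hexp2] at this
        linarith)
    linarith

theorem mem_spectrum_adjMatrix_iff {V : Type*} [Fintype V] [DecidableEq V] (G : SimpleGraph V)
    [DecidableRel G.Adj] (μ : ℝ) : μ ∈ spectrum ℝ (G.adjMatrix ℝ) ↔
      ∃ y : V → ℝ, (∃ v, y v ≠ 0) ∧ ∀ v, μ * y v = ∑ w, G.adjFun v w * y w := by
  rw [← Matrix.spectrum_toLin', ← Module.End.hasEigenvalue_iff_mem_spectrum]
  have hmul : ∀ y : V → ℝ, (Matrix.toLin' (G.adjMatrix ℝ)) y = μ • y ↔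
      ∀ v, μ * y v = ∑ w, G.adjFun v w * y w := fun y => by
    rw [funext_iff]
    refine forall_congr' fun v => ?_
    rw [Matrix.toLin'_apply, Matrix.mulVec, dotProduct, eq_comm]
    simp [adjFun]
  constructor
  · rintro h
    obtain ⟨y, hy⟩ := h.exists_hasEigenvector
    refine ⟨y, Function.ne_iff.1 hy.2, (hmul y).1 hy.apply_eq_smul⟩
  · rintro ⟨y, hy0, hy⟩
    exact Module.End.hasEigenvalue_of_hasEigenvector (x := y)
      ⟨Module.End.mem_eigenspace_iff.2 ((hmul y).2 hy), Function.ne_iff.2 hy0⟩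

theorem graphSpectralRadius_eq_ofReal {V : Type*} [Fintype V] (G : SimpleGraph V) {ρ : ℝ}
    {x : V → ℝ} (hx : ∀ v, 0 ≤ x v) (hx0 : ∃ v, x v ≠ 0)
    (heig : ∀ v, ρ * x v = ∑ w, G.adjFun v w * x w)
    (hray : ∀ y : V → ℝ, ∑ v, ∑ w, G.adjFun v w * (y v * y w) ≤ ρ * ∑ v, y v ^ 2) :
    0 ≤ ρ ∧ graphSpectralRadius G = ENNReal.ofReal ρ := by
  classical
  have hρ : 0 ≤ ρ := by
    obtain ⟨v, hv⟩ := hx0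
    have h1 : 0 ≤ ρ * x v := heig v ▸
      sum_nonneg fun w _ => mul_nonneg (G.adjFun_nonneg v w) (hx w)
    exact nonneg_of_mul_nonneg_left h1 (lt_of_le_of_ne (hx v) hv.symm)
  refine ⟨hρ, ?_⟩
  have hdef : graphSpectralRadius G = ⨆ k ∈ spectrum ℝ (G.adjMatrix ℝ), (‖k‖₊ : ENNReal) := rfl
  rw [hdef]
  have hnorm : ∀ k : ℝ, (‖k‖₊ : ENNReal) = ENNReal.ofReal |k| := fun k => by
    rw [← Real.norm_eq_abs, ofReal_norm, enorm_eq_nnnorm]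
  apply le_antisymm
  · refine iSup₂_le fun k hk => ?_
    rw [hnorm]
    refine ENNReal.ofReal_le_ofReal ?_
    obtain ⟨y, ⟨v₀, hv₀⟩, hy⟩ := (mem_spectrum_adjMatrix_iff G k).1 hk
    have hpos : 0 < ∑ v, y v ^ 2 := sum_pos' (fun _ _ => sq_nonneg _)
      ⟨v₀, mem_univ _, by positivity⟩
    have h1 := hray (fun v => |y v|)
    simp only [sq_abs] at h1
    refine le_of_mul_le_mul_right (le_trans ?_ h1) hpos
    have h2 : k * ∑ v, y v ^ 2 = ∑ v, ∑ w, G.adjFun v w * (y v * y w) := by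
      rw [mul_sum]
      refine sum_congr rfl fun v _ => ?_
      rw [show k * y v ^ 2 = y v * (k * y v) by ring, hy, mul_sum]
      exact sum_congr rfl fun w _ => by ring
    rw [← abs_of_pos hpos, ← abs_mul, h2]
    refine (abs_sum_le_sum_abs _ _).trans (sum_le_sum fun v _ => ?_)
    refine (abs_sum_le_sum_abs _ _).trans (sum_le_sum fun w _ => ?_)
    rw [abs_mul, abs_mul, abs_of_nonneg (G.adjFun_nonneg v w)]
  · have : ρ ∈ spectrum ℝ (G.adjMatrix ℝ) := (mem_spectrum_adjMatrix_iff G ρ).2 ⟨x, hx0, heig⟩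
    refine le_trans ?_ (le_iSup₂ (f := fun k (_ : k ∈ spectrum ℝ (G.adjMatrix ℝ)) =>
      (‖k‖₊ : ENNReal)) ρ this)
    rw [hnorm, abs_of_nonneg hρ]

/-! ### Walks of length two and large entries of the Perron vector. -/

namespace SimpleGraph

variable {V : Type*} [Fintype V]

/-- The degree, as a real number. -/
noncomputable def realDegree (G : SimpleGraph V) (v : V) : ℝ := ∑ w, G.adjFun v w

/-- The number of common neighbours, as a real number. -/
noncomputable def codegree (G : SimpleGraph V) (v w : V) : ℝ := ∑ t, G.adjFun v t * G.adjFun t w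

/-- No three vertices have three common neighbours, i.e. `K₃,₃` is not a subgraph. -/
def NoThreeThree (G : SimpleGraph V) : Prop :=
  ∀ a b c, a ≠ b → a ≠ c → b ≠ c →
    ∑ t, G.adjFun a t * (G.adjFun b t * G.adjFun c t) ≤ 2

/-- `x` is a nonnegative eigenvector for `ρ` with largest entry `x u = 1`. -/
structure IsPerronVector (G : SimpleGraph V) (ρ : ℝ) (x : V → ℝ) (u : V) : Prop where
  nonneg : ∀ v, 0 ≤ x v
  le_one : ∀ v, x v ≤ 1
  eq_one : x u = 1
  eig : ∀ v, ρ * x v = ∑ w, G.adjFun v w * x w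

variable (G : SimpleGraph V)

theorem realDegree_nonneg (v : V) : 0 ≤ G.realDegree v :=
  sum_nonneg fun _ _ => G.adjFun_nonneg _ _

theorem codegree_nonneg (v w : V) : 0 ≤ G.codegree v w :=
  sum_nonneg fun _ _ => mul_nonneg (G.adjFun_nonneg _ _) (G.adjFun_nonneg _ _)

theorem codegree_comm (v w : V) : G.codegree v w = G.codegree w v :=
  sum_congr rfl fun t _ => by rw [mul_comm, G.adjFun_comm t w, G.adjFun_comm v t]

theorem codegree_le_left (v w : V) : G.codegree v w ≤ G.realDegree v :=
  sum_le_sum fun _ _ => mul_le_of_le_one_right (G.adjFun_nonneg _ _) (G.adjFun_le_one _ _)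

theorem codegree_le_right (v w : V) : G.codegree v w ≤ G.realDegree w :=
  (G.codegree_comm v w).trans_le (G.codegree_le_left w v)

theorem codegree_self (v : V) : G.codegree v v = G.realDegree v :=
  sum_congr rfl fun t _ => by rw [G.adjFun_comm t v, adjFun_mul_self]

theorem sum_codegree_eq (v : V) (L : Finset V) :
    ∑ w ∈ L, G.codegree v w = ∑ t, G.adjFun v t * ∑ w ∈ L, G.adjFun t w := by
  simp only [codegree, mul_sum]
  exact sum_comm

theorem sum_codegree_le (v : V) : ∑ w, G.codegree v w ≤ ∑ t, G.realDegree t := by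
  rw [sum_codegree_eq]
  exact sum_le_sum fun t _ => mul_le_of_le_one_left (G.realDegree_nonneg t) (G.adjFun_le_one _ _)

variable {G}

theorem IsPerronVector.sq_eig {ρ : ℝ} {x : V → ℝ} {u : V} (h : G.IsPerronVector ρ x u) (v : V) :
    ρ ^ 2 * x v = ∑ w, G.codegree v w * x w := by
  rw [pow_two, mul_assoc, h.eig, mul_sum]
  simp only [mul_left_comm ρ, h.eig, codegree, sum_mul, mul_sum, mul_assoc]
  exact sum_comm

theorem IsPerronVector.mul_le_realDegree {ρ : ℝ} {x : V → ℝ} {u : V}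
    (h : G.IsPerronVector ρ x u) (v : V) : ρ * x v ≤ G.realDegree v := by
  rw [h.eig]
  exact sum_le_sum fun t _ => mul_le_of_le_one_right (G.adjFun_nonneg _ _) (h.le_one _)

/-- The number of walks of length two from a vertex `s` into a set `H` of other vertices is small when
`s` has small degree. -/
theorem NoThreeThree.sum_codegree_sq_le [DecidableEq V] (hG : G.NoThreeThree) (s : V)
    (H : Finset V) (hs : s ∉ H) :
    (∑ w ∈ H, G.codegree s w) ^ 2 ≤
      G.realDegree s * (∑ w ∈ H, G.codegree s w + 2 * (#H : ℝ) ^ 2) := by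
  -- Cauchy–Schwarz over the neighbours `t` of `s`. Expanding the squares, the diagonal pairs of `H`
  -- give back the codegrees, and each other pair has at most two common neighbours with `s`.
  have h1 : (∑ w ∈ H, G.codegree s w) ^ 2 ≤
      (∑ t, G.adjFun s t ^ 2) * ∑ t, (G.adjFun s t * ∑ w ∈ H, G.adjFun t w) ^ 2 := by
    have : ∑ w ∈ H, G.codegree s w =
        ∑ t, G.adjFun s t * (G.adjFun s t * ∑ w ∈ H, G.adjFun t w) := by
      rw [sum_codegree_eq]
      exact sum_congr rfl fun t _ => by rw [← mul_assoc, adjFun_mul_self]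
    rw [this]
    exact sum_mul_sq_le_sq_mul_sq _ _ _
  have h2 : ∑ t, G.adjFun s t ^ 2 = G.realDegree s :=
    sum_congr rfl fun t _ => by rw [pow_two, adjFun_mul_self]
  rw [h2] at h1
  refine h1.trans (mul_le_mul_of_nonneg_left ?_ (G.realDegree_nonneg s))
  have h3 : ∑ t, (G.adjFun s t * ∑ w ∈ H, G.adjFun t w) ^ 2 =
      ∑ w ∈ H, ∑ w' ∈ H, ∑ t, G.adjFun s t * (G.adjFun w t * G.adjFun w' t) := by
    have : ∀ t, (G.adjFun s t * ∑ w ∈ H, G.adjFun t w) ^ 2 =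
        ∑ w ∈ H, ∑ w' ∈ H, G.adjFun s t * (G.adjFun w t * G.adjFun w' t) := fun t => by
      rw [mul_pow, pow_two, adjFun_mul_self, pow_two, sum_mul_sum, mul_sum]
      refine sum_congr rfl fun w _ => ?_
      rw [mul_sum]
      exact sum_congr rfl fun w' _ => by rw [G.adjFun_comm t w, G.adjFun_comm t w']
    simp only [this]
    rw [sum_comm]
    exact sum_congr rfl fun w _ => sum_comm
  rw [h3]
  have h4 : ∀ w ∈ H, ∀ w' ∈ H, ∑ t, G.adjFun s t * (G.adjFun w t * G.adjFun w' t) ≤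
      (if w = w' then G.codegree s w else 0) + 2 := by
    intro w hw w' hw'
    split_ifs with h
    · subst h
      have : ∑ t, G.adjFun s t * (G.adjFun w t * G.adjFun w t) = G.codegree s w :=
        sum_congr rfl fun t _ => by rw [adjFun_mul_self, G.adjFun_comm w t]
      linarith
    · rw [zero_add]
      exact hG s w w' (fun e => hs (e ▸ hw)) (fun e => hs (e ▸ hw')) h
  refine (sum_le_sum fun w hw => sum_le_sum fun w' hw' => h4 w hw w' hw').trans (le_of_eq ?_)
  simp only [sum_add_distrib, sum_ite_eq, sum_const, nsmul_eq_mul]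
  rw [sum_congr rfl fun w hw => if_pos hw]
  ring

theorem card_filter_mul_le [DecidableEq V] {p : V → Prop} [DecidablePred p] {c m : ℝ}
    (hm : ∑ v, G.realDegree v = 2 * m) (hp : ∀ v, p v → c ≤ G.realDegree v) :
    (#(univ.filter p) : ℝ) * c ≤ 2 * m := by
  rw [← hm, ← nsmul_eq_mul]
  refine (card_nsmul_le_sum _ _ _ fun v hv => hp v (mem_filter.1 hv).2).trans ?_
  exact sum_le_sum_of_subset_of_nonneg (filter_subset _ _) fun v _ _ => G.realDegree_nonneg v

/-- Split `ρ² x s = ∑ codegree s w * x w`. The term `w = s` is the degree of `s`. Vertices of degree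
below `ε ρ` have entry at most `ε` and contribute at most `2εm`. The others form a set `H` of size
at most `2m / (ερ)`, into which `s` has few walks by `sum_codegree_sq_le`. The total is at most
`4εm`. -/
theorem NoThreeThree.entry_le_of_degree_le (hG : G.NoThreeThree) {ρ m ε : ℝ} {x : V → ℝ} {u : V}
    (hx : G.IsPerronVector ρ x u) (hm : ∑ v, G.realDegree v = 2 * m) (hm0 : 0 < m)
    (hρ0 : 0 ≤ ρ) (hρ : m ≤ ρ ^ 2) (hε : 0 < ε) (hε1 : ε ≤ 1) {s : V}
    (hs : G.realDegree s ≤ ε ^ 4 / 10 * m) : x s ≤ 4 * ε := by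
  classical
  set H := (univ.filter fun h => ε * ρ ≤ G.realDegree h).erase s
  set F := ∑ w ∈ H, G.codegree s w
  have hρpos : 0 < ρ := by
    rcases hρ0.eq_or_lt with h | h
    · rw [← h] at hρ; norm_num at hρ; linarith
    · exact h
  have hFm : F ≤ 2 * m := by
    rw [← hm]
    exact (sum_le_sum_of_subset_of_nonneg (subset_univ _)
      fun w _ _ => G.codegree_nonneg _ _).trans (G.sum_codegree_le s)
  have hcard : (#H : ℝ) * (ε * ρ) ≤ 2 * m := by
    refine le_trans ?_ (card_filter_mul_le (G := G) hm (p := fun h => ε * ρ ≤ G.realDegree h)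
      fun _ h => h)
    gcongr
    exact erase_subset _ _
  have hcard2 : ε ^ 2 * (#H : ℝ) ^ 2 ≤ 4 * m := by
    have h1 : ((#H : ℝ) * (ε * ρ)) ^ 2 ≤ (2 * m) ^ 2 := by gcongr
    have h2 : ε ^ 2 * (#H : ℝ) ^ 2 * m ≤ 4 * m * m := by
      calc ε ^ 2 * (#H : ℝ) ^ 2 * m ≤ ε ^ 2 * (#H : ℝ) ^ 2 * ρ ^ 2 := by gcongr
        _ ≤ 4 * m * m := by linarith
    exact le_of_mul_le_mul_right h2 hm0
  have hF : F ≤ ε * m := by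
    have h1 := hG.sum_codegree_sq_le s H (notMem_erase _ _)
    have h2 : F ^ 2 ≤ (ε ^ 4 / 10 * m) * (2 * m + 2 * (#H : ℝ) ^ 2) := by
      refine h1.trans ?_
      have h0 : 0 ≤ F := sum_nonneg fun w _ => G.codegree_nonneg _ _
      gcongr
    -- With `#H ^ 2 ≤ 4m / ε²` the two terms are at most `2/10` and `8/10` of the right side; this
    -- explains the factor `1/10`.
    have h3 : (ε ^ 4 / 10 * m) * (2 * m + 2 * (#H : ℝ) ^ 2) ≤ (ε * m) ^ 2 := by
      have e1 : ε ^ 4 ≤ ε ^ 2 := pow_le_pow_of_le_one hε.le hε1 (by norm_num)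
      have e2 : ε ^ 2 * m * (ε ^ 2 * (#H : ℝ) ^ 2) ≤ ε ^ 2 * m * (4 * m) := by gcongr
      have e3 : ε ^ 4 * m ^ 2 ≤ ε ^ 2 * m ^ 2 := by gcongr
      nlinarith
    exact le_of_sq_le_sq (h2.trans h3) (by positivity)
  have hsplit : ρ ^ 2 * x s ≤ G.realDegree s + F + ε * (2 * m) := by
    rw [hx.sq_eig]
    have : ∀ w ∈ univ, G.codegree s w * x w ≤ (if w = s then G.codegree s w else 0) +
        (if w ∈ H then G.codegree s w else 0) + ε * G.codegree s w := by
      intro w _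
      have h0 := G.codegree_nonneg s w
      have h1 : G.codegree s w * x w ≤ G.codegree s w :=
        mul_le_of_le_one_right h0 (hx.le_one w)
      have h2 : 0 ≤ ε * G.codegree s w := by positivity
      by_cases hws : w = s
      · simp only [hws, if_true] at h0 h1 h2 ⊢
        split_ifs <;> linarith
      by_cases hwH : w ∈ H
      · simp only [hws, hwH, if_true, if_false]; linarith
      · simp only [hws, hwH, if_false, zero_add]
        rw [mul_comm]
        refine mul_le_mul_of_nonneg_right ?_ h0
        have hlt : G.realDegree w < ε * ρ := by
          by_contra! hc
          exact hwH (mem_erase.2 ⟨hws, mem_filter.2 ⟨mem_univ _, hc⟩⟩)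
        have := (hx.mul_le_realDegree w).trans hlt.le
        rw [mul_comm ε] at this
        exact le_of_mul_le_mul_left this hρpos
    refine (sum_le_sum this).trans ?_
    rw [sum_add_distrib, sum_add_distrib, ← mul_sum, sum_ite_eq' univ s, if_pos (mem_univ _),
      codegree_self, sum_ite_mem, univ_inter]
    have := G.sum_codegree_le s
    rw [hm] at this
    gcongr
  have e4 : ε ^ 4 / 10 * m ≤ ε * m := by
    have : ε ^ 4 ≤ ε ^ 1 := pow_le_pow_of_le_one hε.le hε1 (by norm_num)
    gcongr
    linarith
  have : m * x s ≤ m * (4 * ε) := by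
    calc m * x s ≤ ρ ^ 2 * x s := by gcongr; exact hx.nonneg s
      _ ≤ m * (4 * ε) := by linarith
  exact le_of_mul_le_mul_left this hm0

/-- A neighbour of `v` has at most two neighbours in `L`, unless it is a common neighbour of three
vertices of `L`. Each of the at most `#L ^ 3` ordered triples has at most two common neighbours, and
each exceptional vertex sees at most `#L` vertices of `L`. -/
theorem NoThreeThree.sum_codegree_le_two_mul [DecidableEq V] (hG : G.NoThreeThree) (v : V)
    (L : Finset V) :
    ∑ w ∈ L, G.codegree v w ≤ 2 * G.realDegree v + 2 * (#L : ℝ) ^ 4 := by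
  set T := (L ×ˢ (L ×ˢ L)).filter fun p => p.1 ≠ p.2.1 ∧ p.1 ≠ p.2.2 ∧ p.2.1 ≠ p.2.2
  set f : V → V × V × V → ℝ := fun t p => G.adjFun p.1 t * (G.adjFun p.2.1 t * G.adjFun p.2.2 t)
  have hf0 : ∀ t p, 0 ≤ f t p := fun t p => mul_nonneg (G.adjFun_nonneg _ _)
    (mul_nonneg (G.adjFun_nonneg _ _) (G.adjFun_nonneg _ _))
  have hT : (#T : ℝ) ≤ (#L : ℝ) ^ 3 := by
    have : #T ≤ #L ^ 3 := (card_filter_le _ _).trans (by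
      rw [card_product, card_product]; exact le_of_eq (by ring))
    exact_mod_cast this
  have key : ∀ t, ∑ w ∈ L, G.adjFun t w ≤ 2 + #L * ∑ p ∈ T, f t p := by
    classical
    intro t
    have hcard : ∑ w ∈ L, G.adjFun t w = #(L.filter fun w => G.Adj t w) := by
      simp only [adjFun, sum_boole]
    rw [hcard]
    have hnn : 0 ≤ ∑ p ∈ T, f t p := sum_nonneg fun p _ => hf0 t p
    rcases le_or_gt #(L.filter fun w => G.Adj t w) 2 with h | h
    · have : (#(L.filter fun w => G.Adj t w) : ℝ) ≤ 2 := by exact_mod_cast h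
      have : 0 ≤ #L * ∑ p ∈ T, f t p := by positivity
      linarith
    · obtain ⟨a, ha, b, hb, c, hc, hab, hac, hbc⟩ := two_lt_card.1 h
      rw [mem_filter] at ha hb hc
      have hmem : (a, b, c) ∈ T := by simp [T, ha.1, hb.1, hc.1, hab, hac, hbc]
      have h1 : 1 ≤ ∑ p ∈ T, f t p := by
        refine le_trans (le_of_eq ?_) (single_le_sum (fun p _ => hf0 t p) hmem)
        simp [f, G.adjFun_of_adj ha.2.symm, G.adjFun_of_adj hb.2.symm, G.adjFun_of_adj hc.2.symm]
      have h2 : (#(L.filter fun w => G.Adj t w) : ℝ) ≤ #L := by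
        exact_mod_cast card_filter_le _ _
      have h3 : (#L : ℝ) * 1 ≤ #L * ∑ p ∈ T, f t p := by gcongr
      linarith
  rw [sum_codegree_eq]
  calc ∑ t, G.adjFun v t * ∑ w ∈ L, G.adjFun t w
      ≤ ∑ t, (2 * G.adjFun v t + #L * ∑ p ∈ T, f t p) := by
        refine sum_le_sum fun t _ => ?_
        have h0 := G.adjFun_nonneg v t
        have hnn : 0 ≤ #L * ∑ p ∈ T, f t p :=
          mul_nonneg (Nat.cast_nonneg _) (sum_nonneg fun p _ => hf0 t p)
        calc _ ≤ G.adjFun v t * (2 + #L * ∑ p ∈ T, f t p) := by gcongr; exact key t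
          _ ≤ _ := by
            have := mul_le_of_le_one_left hnn (G.adjFun_le_one v t)
            linarith
    _ = 2 * G.realDegree v + #L * ∑ p ∈ T, ∑ t, f t p := by
        rw [sum_add_distrib, ← mul_sum, ← mul_sum, sum_comm]; rfl
    _ ≤ 2 * G.realDegree v + #L * ∑ p ∈ T, 2 := by
        gcongr with p hp
        obtain ⟨-, h1, h2, h3⟩ := mem_filter.1 hp
        exact hG _ _ _ h1 h2 h3
    _ ≤ _ := by
        rw [sum_const, nsmul_eq_mul]
        have : (#L : ℝ) * (#T * 2) ≤ #L * ((#L : ℝ) ^ 3 * 2) := by gcongr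
        linarith

/-- Only edges inside `L` are counted twice. -/
theorem sum_realDegree_le [DecidableEq V] (G : SimpleGraph V) {m : ℝ}
    (hm : ∑ v, G.realDegree v = 2 * m) (L : Finset V) :
    ∑ w ∈ L, G.realDegree w ≤ m + (#L : ℝ) ^ 2 := by
  have h1 : ∑ w ∈ Lᶜ, G.realDegree w ≥ ∑ w ∈ Lᶜ, ∑ z ∈ L, G.adjFun w z :=
    sum_le_sum fun w _ => sum_le_sum_of_subset_of_nonneg (subset_univ _)
      fun _ _ _ => G.adjFun_nonneg _ _
  have h2 : ∑ w ∈ Lᶜ, ∑ z ∈ L, G.adjFun w z + ∑ w ∈ L, ∑ z ∈ L, G.adjFun w z =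
      ∑ z ∈ L, G.realDegree z := by
    rw [sum_compl_add_sum, sum_comm]
    exact sum_congr rfl fun z _ => sum_congr rfl fun w _ => G.adjFun_comm _ _
  have h3 : ∑ w ∈ L, ∑ z ∈ L, G.adjFun w z ≤ (#L : ℝ) ^ 2 := by
    refine (sum_le_sum fun w _ => sum_le_sum fun z _ => G.adjFun_le_one w z).trans (le_of_eq ?_)
    simp [pow_two]
  have h4 := sum_compl_add_sum L G.realDegree
  have h5 : 0 ≤ (#L : ℝ) ^ 2 := by positivity
  linarith

/-- Besides the vertex `u` of largest entry there is at most one vertex with a large entry in the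
eigenvector, and it shares almost half of the edges with `u`. -/
theorem NoThreeThree.codegree_of_entry_large :
    ∃ M : ℝ, ∀ {V : Type*} [Fintype V] {G : SimpleGraph V}, G.NoThreeThree →
      ∀ {ρ m : ℝ} {x : V → ℝ} {u : V}, G.IsPerronVector ρ x u → ∑ v, G.realDegree v = 2 * m →
      M ≤ m → 0 ≤ ρ → m ≤ ρ ^ 2 → ∀ v, v ≠ u → 1 / 2 < x v →
      4 / 10 * m ≤ G.codegree u v ∧ ∀ z, z ≠ u → z ≠ v → x z ≤ 1 / 5 := by
  -- The threshold of `entry_le_of_degree_le` for `ε = 1/4000`, so entries off `L` are at most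
  -- `1/1000`. Since `#L ≤ 2/δ`, the bound on `m` makes the error `2 * #L ^ 4` at most `m / 1000`.
  set δ : ℝ := (1 / 4000) ^ 4 / 10 with hδ
  refine ⟨2000 * (2 / δ) ^ 4, fun {V} _ {G} hG {ρ m x u} hx hm hM hρ0 hρ v hvu hv => ?_⟩
  classical
  have hδ0 : 0 < δ := by norm_num [hδ]
  have hm0 : 0 < m := lt_of_lt_of_le (by positivity) hM
  set L := univ.filter fun w => δ * m < G.realDegree w
  have hlow : ∀ w, w ∉ L → x w ≤ 1 / 1000 := by
    intro w hw
    have : G.realDegree w ≤ δ * m := by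
      by_contra! hc
      exact hw (mem_filter.2 ⟨mem_univ _, hc⟩)
    have := hG.entry_le_of_degree_le hx hm hm0 hρ0 hρ (ε := 1 / 4000) (by norm_num) (by norm_num)
      this
    linarith
  have hL : (#L : ℝ) ≤ 2 / δ := by
    have := card_filter_mul_le (G := G) hm (p := fun w => δ * m < G.realDegree w)
      (c := δ * m) fun _ h => h.le
    rw [le_div_iff₀ hδ0]
    refine le_of_mul_le_mul_right ?_ hm0
    linarith
  have hL4 : 2 * (#L : ℝ) ^ 4 ≤ m / 1000 := by
    have : (#L : ℝ) ^ 4 ≤ (2 / δ) ^ 4 := by gcongr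
    linarith
  have hL2 : (#L : ℝ) ^ 2 ≤ m / 1000 := by
    have : (#L) ^ 2 ≤ (#L) ^ 4 := by
      rcases Nat.eq_zero_or_pos #L with h | h
      · simp [h]
      · exact Nat.pow_le_pow_right h (by norm_num)
    have h' : (#L : ℝ) ^ 2 ≤ (#L : ℝ) ^ 4 := by exact_mod_cast this
    have : (0 : ℝ) ≤ (#L : ℝ) ^ 2 := by positivity
    linarith
  have hB : ∀ w, m * x w ≤ ∑ w' ∈ L, G.codegree w w' * x w' + m / 500 := by
    intro w
    have h1 : m * x w ≤ ρ ^ 2 * x w := mul_le_mul_of_nonneg_right hρ (hx.nonneg w)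
    have h2 : ∑ w' ∈ Lᶜ, G.codegree w w' * x w' ≤ ∑ w' ∈ Lᶜ, G.codegree w w' * (1 / 1000) :=
      sum_le_sum fun w' hw' => mul_le_mul_of_nonneg_left (hlow w' (mem_compl.1 hw'))
        (G.codegree_nonneg _ _)
    have h3 : ∑ w' ∈ Lᶜ, G.codegree w w' ≤ 2 * m := by
      rw [← hm]
      exact (sum_le_sum_of_subset_of_nonneg (subset_univ _)
        fun w _ _ => G.codegree_nonneg _ _).trans (G.sum_codegree_le w)
    rw [← sum_mul] at h2
    rw [hx.sq_eig, ← sum_compl_add_sum L] at h1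
    linarith
  have hBC : ∀ w, m * x w ≤ 2 * G.realDegree w + 3 * m / 1000 := by
    intro w
    have h1 := hG.sum_codegree_le_two_mul w L
    have h2 : ∑ w' ∈ L, G.codegree w w' * x w' ≤ ∑ w' ∈ L, G.codegree w w' :=
      sum_le_sum fun w' _ => mul_le_of_le_one_right (G.codegree_nonneg _ _) (hx.le_one _)
    linarith [hB w]
  have hterm : ∀ w, G.codegree u w * x w ≤ G.realDegree w := fun w =>
    (mul_le_of_le_one_right (G.codegree_nonneg _ _) (hx.le_one _)).trans (G.codegree_le_right _ _)
  -- The equation at `u` is almost tight: `∑ codegree u w * x w` over `L` is at least `m - m/500`,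
  -- the degrees in `L` sum to at most `m + m/1000`, and the comparison holds term by term. So no
  -- single term can lose more than `3m/1000`.
  have hdef : ∀ w ∈ L, G.realDegree w - G.codegree u w * x w ≤ 3 * m / 1000 := by
    intro w hw
    refine (single_le_sum (f := fun w => G.realDegree w - G.codegree u w * x w)
      (fun w _ => sub_nonneg.2 (hterm w)) hw).trans ?_
    rw [sum_sub_distrib]
    have h1 := sum_realDegree_le G hm L
    have h2 := hB u
    rw [hx.eq_one] at h2
    linarith
  have hvL : v ∈ L := by
    by_contra h
    linarith [hlow v h]
  have huL : u ∈ L := by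
    by_contra h
    linarith [hlow u h, hx.eq_one]
  have hd1 := hBC v
  have hd2 := hdef v hvL
  have hx1 := hx.le_one v
  have hxv : 98 / 100 ≤ x v := by
    have h1 : G.realDegree v * (1 - x v) ≤ 3 * m / 1000 := by
      have : G.codegree u v * x v ≤ G.realDegree v * x v :=
        mul_le_mul_of_nonneg_right (G.codegree_le_right _ _) (hx.nonneg v)
      linarith
    have h2 : (m * (497 / 1000)) * (1 - x v) ≤ 2 * G.realDegree v * (1 - x v) := by
      refine mul_le_mul_of_nonneg_right ?_ (by linarith)
      have : m * (1 / 2) ≤ m * x v := by gcongr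
      linarith
    have h3 : m * ((497 / 1000) * (1 - x v)) ≤ m * (6 / 1000) := by linarith
    have h4 := le_of_mul_le_mul_left h3 hm0
    linarith
  have hdv : 488 / 1000 * m ≤ G.realDegree v := by
    have : m * (98 / 100) ≤ m * x v := by gcongr
    linarith
  have hco : 485 / 1000 * m ≤ G.codegree u v := by
    have : G.codegree u v * x v ≤ G.codegree u v :=
      mul_le_of_le_one_right (G.codegree_nonneg _ _) hx1
    linarith
  refine ⟨by linarith, fun z hzu hzv => ?_⟩
  by_cases hz : z ∈ L
  -- `u` and `v` already have degree almost `m/2` each, which leaves `z` a small degree and hence a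
  -- small entry.
  · have h1 : ∑ w ∈ ({u, v, z} : Finset V), G.realDegree w ≤ ∑ w ∈ L, G.realDegree w :=
      sum_le_sum_of_subset_of_nonneg (by
        intro w hw
        simp only [mem_insert, mem_singleton] at hw
        rcases hw with rfl | rfl | rfl <;> assumption) fun w _ _ => G.realDegree_nonneg w
    rw [sum_insert (by simp [hvu.symm, hzu.symm]), sum_insert (by simp [hzv.symm]),
      sum_singleton] at h1
    have h2 := sum_realDegree_le G hm L
    have h3 := G.codegree_le_left u v
    have h4 : m * x z ≤ m * (1 / 5) := by linarith [hBC z]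
    exact le_of_mul_le_mul_left h4 hm0
  · linarith [hlow z hz]

end SimpleGraph

/-! ### The deficit `m - ρ² + ρ` and the structure it forces. -/

namespace SimpleGraph

/-- The contribution of a pair of vertices to the difference of the number of edges and `ρ²`. -/
noncomputable def pairDeficit {V : Type*} (G : SimpleGraph V) (x : V → ℝ) (u y w : V) : ℝ :=
  G.adjFun y w * (1 - G.adjFun u y * x w - G.adjFun u w * x y)

theorem pairDeficit_comm {V : Type*} {G : SimpleGraph V} (x : V → ℝ) (u y w : V) :
    G.pairDeficit x u y w = G.pairDeficit x u w y := by
  rw [pairDeficit, pairDeficit, G.adjFun_comm y w]; ring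

variable {V : Type*} [Fintype V]

theorem sum_sum_eq_of_symm [DecidableEq V] {Φ : V → V → ℝ} (hsymm : ∀ y w, Φ y w = Φ w y)
    (hdiag : ∀ y, Φ y y = 0) {u v : V} (huv : u ≠ v) :
    ∑ y, ∑ w, Φ y w = 2 * Φ u v + 2 * ∑ w ∈ univ \ {u, v}, (Φ u w + Φ v w) +
      ∑ y ∈ univ \ {u, v}, ∑ w ∈ univ \ {u, v}, Φ y w := by
  have h : ∀ f : V → ℝ, ∑ w, f w = f u + f v + ∑ w ∈ univ \ {u, v}, f w := fun f => by
    rw [← sum_sdiff (subset_univ {u, v}), sum_pair huv, add_comm]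
  rw [h]
  simp only [h (Φ _), sum_add_distrib, hdiag, hsymm v u]
  rw [sum_congr rfl fun y _ => hsymm y u, sum_congr rfl fun y _ => hsymm y v]
  ring

variable {G : SimpleGraph V}

/-- As `x u = 1`, `ρ²` is the weighted sum over walks of length two from `u`; an edge `yw` is the
second step of such a walk in either direction. -/
theorem IsPerronVector.sum_pairDeficit {ρ m : ℝ} {x : V → ℝ} {u : V}
    (hx : G.IsPerronVector ρ x u) (hm : ∑ v, G.realDegree v = 2 * m) :
    ∑ y, ∑ w, G.pairDeficit x u y w = 2 * (m - ρ ^ 2) := by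
  have h1 : ∑ y, ∑ w, G.adjFun y w * (G.adjFun u y * x w) = ρ ^ 2 := by
    have := hx.sq_eig u
    rw [hx.eq_one, mul_one] at this
    rw [this]
    simp only [codegree, sum_mul]
    rw [sum_comm]
    exact sum_congr rfl fun y _ => sum_congr rfl fun w _ => by ring
  have h2 : ∑ y, ∑ w, G.adjFun y w * (G.adjFun u w * x y) = ρ ^ 2 := by
    rw [← h1, sum_comm]
    exact sum_congr rfl fun y _ => sum_congr rfl fun w _ => by rw [G.adjFun_comm w y]
  have h3 : ∀ y w, G.pairDeficit x u y w = G.adjFun y w -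
      G.adjFun y w * (G.adjFun u y * x w) - G.adjFun y w * (G.adjFun u w * x y) := fun y w => by
    rw [pairDeficit]; ring
  simp only [h3, sum_sub_distrib, h1, h2]
  rw [show ∑ y, ∑ w, G.adjFun y w = 2 * m from hm]; ring

theorem IsPerronVector.pairDeficit_self {ρ : ℝ} {x : V → ℝ} {u : V}
    (hx : G.IsPerronVector ρ x u) (w : V) : G.pairDeficit x u u w = 0 := by
  rw [pairDeficit, adjFun_self, hx.eq_one]
  rcases G.adjFun_eq_zero_or_one u w with h | h <;> rw [h] <;> ring

/-- If all neighbours of `u` had entry at most `1/2`, no pair deficit would be negative,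
contradicting `m < ρ²`. -/
theorem IsPerronVector.exists_adj_entry_large {ρ m : ℝ} {x : V → ℝ} {u : V}
    (hx : G.IsPerronVector ρ x u) (hm : ∑ v, G.realDegree v = 2 * m) (hρ : m < ρ ^ 2) :
    ∃ v, G.Adj u v ∧ 1 / 2 < x v := by
  by_contra! hcon
  have h := hx.sum_pairDeficit hm
  have hnn : 0 ≤ ∑ y, ∑ w, G.pairDeficit x u y w := by
    refine sum_nonneg fun y _ => sum_nonneg fun w _ => ?_
    rw [pairDeficit]
    refine mul_nonneg (G.adjFun_nonneg _ _) ?_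
    have key : ∀ y, G.adjFun u y = 0 ∨ (G.adjFun u y = 1 ∧ x y ≤ 1 / 2) := fun y => by
      by_cases hy : G.Adj u y
      · exact Or.inr ⟨G.adjFun_of_adj hy, hcon y hy⟩
      · exact Or.inl (G.adjFun_of_not_adj hy)
    rcases key y with h1 | ⟨h1, h1'⟩ <;> rcases key w with h2 | ⟨h2, h2'⟩ <;> rw [h1, h2] <;>
      linarith [hx.le_one y, hx.le_one w]
  linarith

section

variable [DecidableEq V] {ρ m : ℝ} {x : V → ℝ} {u v : V}

/-- Pairs containing `u` contribute nothing. Adding `ρ`, the sum of the entries at the neighbours of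
`u`, compensates the negative contributions of edges at `v`: a common neighbour `w` is left with `1
- x v`. -/
theorem IsPerronVector.deficit_eq (hx : G.IsPerronVector ρ x u)
    (hm : ∑ v, G.realDegree v = 2 * m) (huv : G.Adj u v) :
    m - ρ ^ 2 + ρ = x v + ∑ w ∈ univ \ {u, v}, (G.adjFun u w * x w +
      G.adjFun v w * (1 - x w - G.adjFun u w * x v)) +
      (∑ y ∈ univ \ {u, v}, ∑ w ∈ univ \ {u, v}, G.pairDeficit x u y w) / 2 := by
  have h1 := hx.sum_pairDeficit hm
  rw [sum_sum_eq_of_symm (pairDeficit_comm x u) (fun y => by simp [pairDeficit]) huv.ne] at h1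
  simp only [hx.pairDeficit_self, zero_add] at h1
  have h2 := hx.eig u
  rw [hx.eq_one, ← sum_sdiff (subset_univ {u, v}), sum_pair huv.ne, adjFun_self,
    G.adjFun_of_adj huv] at h2
  rw [sum_add_distrib]
  have h3 : ∑ w ∈ univ \ {u, v}, G.pairDeficit x u v w =
      ∑ w ∈ univ \ {u, v}, G.adjFun v w * (1 - x w - G.adjFun u w * x v) :=
    sum_congr rfl fun w _ => by rw [pairDeficit, G.adjFun_of_adj huv, one_mul]
  linarith

/-- If the deficit is at most `3/2`, then all edges contain `u` or `v`, and the neighbours of `v` are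
neighbours of `u`. -/
theorem IsPerronVector.structure_of_deficit_le (hx : G.IsPerronVector ρ x u)
    (hm : ∑ v, G.realDegree v = 2 * m) (huv : G.Adj u v) (hco : 1 ≤ G.codegree u v)
    (hsmall : ∀ z, z ≠ u → z ≠ v → x z ≤ 1 / 5) (hdef : m - ρ ^ 2 + ρ ≤ 3 / 2) :
    (∀ w, w ≠ u → G.Adj v w → G.Adj u w) ∧
    ∀ y w, y ≠ u → y ≠ v → w ≠ u → w ≠ v → ¬ G.Adj y w := by
  set R : Finset V := univ \ {u, v}
  have hR : ∀ w, w ∈ R ↔ w ≠ u ∧ w ≠ v := fun w => by simp [R]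
  have heq := hx.deficit_eq hm huv
  -- The contribution of `w` beyond the `1 - x v` of a common neighbour: `0` for common neighbours,
  -- `x w` for neighbours of `u` alone, `1 - x w` for neighbours of `v` alone.
  set f : V → ℝ := fun w => G.adjFun u w * x w + G.adjFun v w * (1 - x w - G.adjFun u w * x v) -
    G.adjFun u w * G.adjFun w v * (1 - x v) with hf
  have hf0 : ∀ w ∈ R, 0 ≤ f w := fun w hw => by
    have h0 := hx.nonneg w
    have h1 := hx.le_one w
    simp only [hf, G.adjFun_comm w v]
    rcases G.adjFun_eq_zero_or_one u w with h | h <;>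
      rcases G.adjFun_eq_zero_or_one v w with h' | h' <;> rw [h, h'] <;> linarith
  have hcosum : ∑ w ∈ R, G.adjFun u w * G.adjFun w v = G.codegree u v := by
    rw [codegree, ← sum_sdiff (subset_univ {u, v}), sum_pair huv.ne]
    simp [R]
  have hsum : ∑ w ∈ R, (G.adjFun u w * x w + G.adjFun v w * (1 - x w - G.adjFun u w * x v)) =
      ∑ w ∈ R, f w + G.codegree u v * (1 - x v) := by
    rw [← hcosum, sum_mul, ← sum_add_distrib]
    exact sum_congr rfl fun w _ => by simp only [hf]; ring
  -- With `x v` this accounts for `1` of the deficit, leaving `1/2`. A neighbour of `v` alone would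
  -- cost at least `4/5`, an edge avoiding `u` and `v` at least `3/5`.
  have hmain : 1 - x v ≤ G.codegree u v * (1 - x v) :=
    le_mul_of_one_le_left (by linarith [hx.le_one v]) hco
  have hpd : ∀ y ∈ R, ∀ w ∈ R, 3 / 5 * G.adjFun y w ≤ G.pairDeficit x u y w := by
    intro y hy w hw
    rw [pairDeficit, mul_comm]
    refine mul_le_mul_of_nonneg_left ?_ (G.adjFun_nonneg _ _)
    have key : ∀ a ∈ R, ∀ b, G.adjFun u b * x a ≤ 1 / 5 := fun a ha b => by
      have := hsmall a ((hR a).1 ha).1 ((hR a).1 ha).2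
      exact (mul_le_of_le_one_left (hx.nonneg a) (G.adjFun_le_one _ _)).trans this
    linarith [key y hy w, key w hw y]
  have hpd0 : ∀ y ∈ R, ∀ w ∈ R, 0 ≤ G.pairDeficit x u y w := fun y hy w hw =>
    (mul_nonneg (by norm_num) (G.adjFun_nonneg _ _)).trans (hpd y hy w hw)
  have hpdsum : 0 ≤ ∑ y ∈ R, ∑ w ∈ R, G.pairDeficit x u y w :=
    sum_nonneg fun y hy => sum_nonneg fun w hw => hpd0 y hy w hw
  have hfsum : 0 ≤ ∑ w ∈ R, f w := sum_nonneg hf0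
  constructor
  · intro w hwu hvw
    by_contra huw
    have hwR : w ∈ R := (hR w).2 ⟨hwu, hvw.ne'⟩
    have h1 : f w ≤ ∑ w ∈ R, f w := single_le_sum hf0 hwR
    have h2 : f w = 1 - x w := by
      simp [hf, G.adjFun_of_adj hvw, G.adjFun_of_not_adj huw]
    linarith [hsmall w hwu hvw.ne']
  · intro y w hyu hyv hwu hwv hyw
    have hyR : y ∈ R := (hR y).2 ⟨hyu, hyv⟩
    have hwR : w ∈ R := (hR w).2 ⟨hwu, hwv⟩
    have h1 : ∑ y' ∈ ({y, w} : Finset V), ∑ w' ∈ R, G.pairDeficit x u y' w' ≤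
        ∑ y' ∈ R, ∑ w' ∈ R, G.pairDeficit x u y' w' :=
      sum_le_sum_of_subset_of_nonneg (by simp [insert_subset_iff, hyR, hwR])
        fun y' hy' _ => sum_nonneg fun w' hw' => hpd0 y' hy' w' hw'
    rw [sum_pair hyw.ne] at h1
    have h2 := single_le_sum (fun w' hw' => hpd0 y hyR w' hw') hwR
    have h3 := single_le_sum (fun w' hw' => hpd0 w hwR w' hw') hyR
    have h4 := hpd y hyR w hwR
    have h5 := hpd w hwR y hyR
    rw [G.adjFun_of_adj hyw] at h4
    rw [G.adjFun_of_adj hyw.symm] at h5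
    linarith

/-- The number of edges and the eigenvalue equations when every vertex other than `u`, `v` is
adjacent to `u`, and otherwise at most to `v`. -/
theorem IsPerronVector.counts_of_structure [DecidableRel G.Adj] (hx : G.IsPerronVector ρ x u)
    (hρ : 0 < ρ)
    (hm : ∑ v, G.realDegree v = 2 * m) (huv : G.Adj u v) (hu : ∀ w, w ≠ u → G.Adj u w)
    (hR : ∀ y w, y ≠ u → y ≠ v → w ≠ u → w ≠ v → ¬ G.Adj y w) {a b : ℕ}
    (ha : #{w ∈ univ \ {u, v} | G.Adj v w} = a) (hb : #{w ∈ univ \ {u, v} | ¬ G.Adj v w} = b) :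
    m = 1 + 2 * a + b ∧ G.codegree u v = a ∧ (1 - x v) * (ρ + 1) = b / ρ ∧
      m - ρ ^ 2 + ρ = x v + a * (1 - x v) + b / ρ := by
  set R : Finset V := univ \ {u, v}
  have hmem : ∀ w, w ∈ R ↔ w ≠ u ∧ w ≠ v := fun w => by simp [R]
  have hAR : ∑ w ∈ R, G.adjFun v w = a := by
    rw [← ha, ← sum_boole]
    exact sum_congr rfl fun w _ => by
      split_ifs with h
      · exact G.adjFun_of_adj h
      · exact G.adjFun_of_not_adj h
  have hu1 : ∀ w ∈ R, G.adjFun u w = 1 := fun w hw => G.adjFun_of_adj (hu w ((hmem w).1 hw).1)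
  have hcard : (#R : ℝ) = a + b := by
    rw [← ha, ← hb, ← Nat.cast_add, card_filter_add_card_filter_not]
  have hm' : m = 1 + 2 * a + b := by
    have h1 : ∑ y, ∑ w, G.adjFun y w = 2 * m := hm
    rw [sum_sum_eq_of_symm G.adjFun_comm G.adjFun_self huv.ne, sum_add_distrib,
      sum_congr rfl hu1, hAR, G.adjFun_of_adj huv,
      sum_eq_zero (s := R) fun y hy => sum_eq_zero fun w hw => G.adjFun_of_not_adj
        (hR y w ((hmem y).1 hy).1 ((hmem y).1 hy).2 ((hmem w).1 hw).1 ((hmem w).1 hw).2)] at h1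
    simp only [sum_const, nsmul_eq_mul, mul_one, hcard] at h1
    linarith
  have hco : G.codegree u v = a := by
    rw [codegree, ← sum_sdiff (subset_univ {u, v}), sum_pair huv.ne, ← hAR]
    simp only [adjFun_self, zero_mul, mul_zero, add_zero]
    exact sum_congr rfl fun w hw => by rw [hu1 w hw, one_mul, G.adjFun_comm]
  have hleaf : ∀ w ∈ R, ¬ G.Adj v w → x w = 1 / ρ := by
    intro w hw hvw
    have h1 := hx.eig w
    rw [← sum_sdiff (subset_univ {u, v}), sum_pair huv.ne, G.adjFun_comm w u, hu1 w hw,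
      G.adjFun_comm w v, G.adjFun_of_not_adj hvw, hx.eq_one,
      sum_eq_zero fun z hz => by
        rw [G.adjFun_of_not_adj
          (hR w z ((hmem w).1 hw).1 ((hmem w).1 hw).2 ((hmem z).1 hz).1 ((hmem z).1 hz).2),
          zero_mul]] at h1
    rw [eq_div_iff hρ.ne']; linarith
  have hB : ∑ w ∈ R, (1 - G.adjFun v w) * x w = b / ρ := by
    rw [← hb, div_eq_mul_one_div, ← nsmul_eq_mul, ← sum_const, sum_filter]
    refine sum_congr rfl fun w hw => ?_
    split_ifs with h
    · rw [G.adjFun_of_adj h]; ring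
    · rw [G.adjFun_of_not_adj h, hleaf w hw h]; ring
  have hequ : ρ = x v + ∑ w ∈ R, x w := by
    have h1 := hx.eig u
    rw [hx.eq_one, ← sum_sdiff (subset_univ {u, v}), sum_pair huv.ne, adjFun_self,
      G.adjFun_of_adj huv, sum_congr rfl fun w hw => by rw [hu1 w hw, one_mul]] at h1
    linarith
  have heqv : ρ * x v = 1 + ∑ w ∈ R, G.adjFun v w * x w := by
    have h1 := hx.eig v
    rw [← sum_sdiff (subset_univ {u, v}), sum_pair huv.ne, adjFun_self,
      G.adjFun_of_adj huv.symm, hx.eq_one] at h1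
    linarith
  have hB' : ∑ w ∈ R, x w - ∑ w ∈ R, G.adjFun v w * x w = b / ρ := by
    rw [← hB, ← sum_sub_distrib]
    exact sum_congr rfl fun w _ => by ring
  -- The third claim is the difference of the eigenvalue equations at `u` and at `v`.
  refine ⟨hm', hco, by linarith, ?_⟩
  rw [hx.deficit_eq hm huv, sum_eq_zero (s := R) fun y hy => sum_eq_zero fun w hw => by
    rw [pairDeficit, G.adjFun_of_not_adj
      (hR y w ((hmem y).1 hy).1 ((hmem y).1 hy).2 ((hmem w).1 hw).1 ((hmem w).1 hw).2), zero_mul]]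
  have : ∑ w ∈ R, (G.adjFun u w * x w + G.adjFun v w * (1 - x w - G.adjFun u w * x v)) =
      ∑ w ∈ R, (1 - G.adjFun v w) * x w + (∑ w ∈ R, G.adjFun v w) * (1 - x v) := by
    rw [sum_mul, ← sum_add_distrib]
    exact sum_congr rfl fun w hw => by rw [hu1 w hw]; ring
  rw [this, hB, hAR]; ring

end

/-- A large graph without isolated vertices and without `K₃,₃` whose spectral radius is as large as
that of the extremal graph consists of two adjacent vertices `u`, `v`, of `a` common neighbours, and of
`b` leaves at `u`, with no further edges. -/
theorem NoThreeThree.exists_structure :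
    ∃ M : ℝ, ∀ {V : Type*} [Fintype V] [DecidableEq V] {G : SimpleGraph V} [DecidableRel G.Adj],
      G.NoThreeThree → (∀ v, ¬ G.IsIsolated v) →
      ∀ {ρ m : ℝ} {x : V → ℝ} {u : V}, G.IsPerronVector ρ x u → ∑ v, G.realDegree v = 2 * m →
      M ≤ m → 2 ≤ ρ → m - ρ ^ 2 + ρ ≤ 3 / 2 →
      ∃ v, G.Adj u v ∧ (∀ w, w ≠ u → G.Adj u w) ∧
        (∀ y w, y ≠ u → y ≠ v → w ≠ u → w ≠ v → ¬ G.Adj y w) ∧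
        m = 1 + 2 * (#{w ∈ univ \ {u, v} | G.Adj v w} : ℕ) +
          (#{w ∈ univ \ {u, v} | ¬ G.Adj v w} : ℕ) ∧
        #{w ∈ univ \ {u, v} | ¬ G.Adj v w} ≤ 2 ∧
        (m - ρ ^ 2 + ρ ≤ 1 → #{w ∈ univ \ {u, v} | ¬ G.Adj v w} = 0) := by
  obtain ⟨M, hM⟩ := NoThreeThree.codegree_of_entry_large
  refine ⟨max M 100, fun {V} _ _ {G} _ hG hiso {ρ m x u} hx hm hmM hρ2 hdef => ?_⟩
  have hm100 : 100 ≤ m := (le_max_right _ _).trans hmM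
  have hρm : m < ρ ^ 2 := by linarith
  obtain ⟨v, huv, hv⟩ := hx.exists_adj_entry_large hm hρm
  obtain ⟨hco, hsmall⟩ := hM hG hx hm ((le_max_left _ _).trans hmM) (by linarith) hρm.le v huv.ne' hv
  obtain ⟨h1, h2⟩ := hx.structure_of_deficit_le hm huv (by linarith) hsmall hdef
  have hu : ∀ w, w ≠ u → G.Adj u w := by
    intro w hwu
    by_cases hwv : w = v
    · exact hwv ▸ huv
    by_contra huw
    refine hiso w fun z hz => ?_
    by_cases hzu : z = u
    · exact huw (hzu ▸ hz.symm)
    by_cases hzv : z = v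
    · exact huw (h1 w hwu (hzv ▸ hz.symm))
    exact h2 w z hwu hwv hzu hzv hz
  obtain ⟨hm', hcoa, hxv, hde⟩ := hx.counts_of_structure (by linarith) hm huv hu h2 rfl rfl
  set a := #{w ∈ univ \ {u, v} | G.Adj v w}
  set b := #{w ∈ univ \ {u, v} | ¬ G.Adj v w}
  rw [hcoa] at hco
  have hx1 := hx.le_one v
  have hρ0 : 0 < ρ := by linarith
  have ha : 1 - x v ≤ a * (1 - x v) := le_mul_of_one_le_left (by linarith) (by linarith)
  refine ⟨v, huv, hu, h2, hm', ?_, fun hde1 => ?_⟩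
  -- Three leaves would give `1 - x v ≥ 3 / (2m)`, and since `a ≥ 4m/10` the part `(a - 1) * (1 - x
  -- v)` of the deficit would exceed the available `1/2`.
  · by_contra! hb
    have hb3 : (3 : ℝ) ≤ b := by exact_mod_cast hb
    have hbρ : 0 ≤ (b : ℝ) / ρ := by positivity
    have hρm2 : ρ ≤ m / 2 := by
      by_contra! hc
      nlinarith
    have hρsq : ρ * (ρ + 1) ≤ 2 * m := by nlinarith
    have h3 : 3 ≤ (1 - x v) * (2 * m) := by
      have e : (1 - x v) * (ρ * (ρ + 1)) = b := by
        rw [mul_left_comm, hxv]; field_simp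
      calc (3 : ℝ) ≤ b := hb3
        _ = (1 - x v) * (ρ * (ρ + 1)) := e.symm
        _ ≤ _ := by gcongr
    have h4 : (4 / 10 * m - 1) * (1 - x v) ≤ (a - 1) * (1 - x v) := by
      gcongr
    have h5 : (4 / 10 * m - 1) * (1 - x v) ≤ 1 / 2 := by linarith
    have h6 : (39 / 100 * m) * (1 - x v) ≤ (4 / 10 * m - 1) * (1 - x v) := by
      gcongr; linarith
    linarith
  · have h0 : (b : ℝ) / ρ ≤ 0 := by linarith
    have h1 : (b : ℝ) ≤ 0 := by
      rwa [div_le_iff₀ hρ0, zero_mul] at h0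
    exact_mod_cast le_antisymm h1 (Nat.cast_nonneg b)

end SimpleGraph

/-! ### Books with leaves: isomorphism, lower bound, the extremal graphs. -/

namespace SimpleGraph

/-- `G` consists of two adjacent vertices `u`, `v`, of `a` common neighbours of them, and of `b` leaves
at `u`. -/
structure IsBookWithLeaves {V : Type*} [Fintype V] [DecidableEq V] (G : SimpleGraph V)
    [DecidableRel G.Adj] (u v : V) (a b : ℕ) : Prop where
  adj : G.Adj u v
  adj_left : ∀ w, w ≠ u → G.Adj u w
  not_adj : ∀ y w, y ≠ u → y ≠ v → w ≠ u → w ≠ v → ¬ G.Adj y w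
  card_adj : #{w ∈ univ \ {u, v} | G.Adj v w} = a
  card_not_adj : #{w ∈ univ \ {u, v} | ¬ G.Adj v w} = b

section

variable {V : Type*} [Fintype V] [DecidableEq V] {G : SimpleGraph V} [DecidableRel G.Adj]
  {u v : V} {a b : ℕ}

/-- The role of a vertex: `u`, `v`, a common neighbour of the two, or a leaf. -/
def bookRole (G : SimpleGraph V) [DecidableRel G.Adj] (u v w : V) : Fin 4 :=
  if w = u then 0 else if w = v then 1 else if G.Adj v w then 2 else 3

/-- Adjacency depends only on the roles, so a bijection preserving roles is an isomorphism. -/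
theorem IsBookWithLeaves.adj_iff (h : G.IsBookWithLeaves u v a b) (y w : V) :
    G.Adj y w ↔ (bookRole G u v y, bookRole G u v w) ∈
      ({(0, 1), (1, 0), (0, 2), (2, 0), (0, 3), (3, 0), (1, 2), (2, 1)} : Finset (Fin 4 × Fin 4)) := by
  have huv := h.adj.ne
  have h1 := h.adj
  have h1' := h.adj.symm
  by_cases hyu : y = u
  · subst hyu
    by_cases hwy : w = y
    · subst hwy; simp [bookRole]
    · have := h.adj_left w hwy
      simp only [this, true_iff, bookRole, if_true, hwy, if_false]
      split_ifs <;> decide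
  by_cases hwu : w = u
  · subst hwu
    have := (h.adj_left y hyu).symm
    simp only [this, true_iff, bookRole, if_true, hyu, if_false]
    split_ifs <;> decide
  by_cases hyv : y = v
  · subst hyv
    by_cases hwy : w = y
    · subst hwy; simp [bookRole, hyu]
    · by_cases hyw : G.Adj y w <;> simp [bookRole, hyu, hwu, hwy, hyw]
  by_cases hwv : w = v
  · subst hwv
    rw [G.adj_comm]
    by_cases hyw : G.Adj w y <;> simp [bookRole, hyu, hwu, hyv, hyw]
  · simp only [h.not_adj y w hyu hyv hwu hwv, false_iff, bookRole, hyu, hwu, hyv, hwv, if_false]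
    split_ifs <;> decide

theorem IsBookWithLeaves.card_role (h : G.IsBookWithLeaves u v a b) (i : Fin 4) :
    Fintype.card {w // bookRole G u v w = i} = ![1, 1, a, b] i := by
  have huv := h.adj.ne
  rw [Fintype.card_subtype]
  obtain rfl | rfl | rfl | rfl : i = 0 ∨ i = 1 ∨ i = 2 ∨ i = 3 := by revert i; decide
  · refine card_eq_one.2 ⟨u, ?_⟩
    ext w
    simp only [mem_filter, mem_univ, true_and, mem_singleton]
    unfold bookRole
    split_ifs <;> simp_all
  · refine card_eq_one.2 ⟨v, ?_⟩
    ext w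
    simp only [mem_filter, mem_univ, true_and, mem_singleton]
    unfold bookRole
    split_ifs with h1 <;> simp_all
  · refine Eq.trans (congrArg card ?_) h.card_adj
    ext w
    simp only [mem_filter, mem_univ, true_and, mem_sdiff, mem_insert, mem_singleton]
    unfold bookRole
    split_ifs <;> simp_all
  · refine Eq.trans (congrArg card ?_) h.card_not_adj
    ext w
    simp only [mem_filter, mem_univ, true_and, mem_sdiff, mem_insert, mem_singleton]
    unfold bookRole
    split_ifs <;> simp_all

theorem IsBookWithLeaves.nonempty_iso (h : G.IsBookWithLeaves u v a b) {W : Type*} [Fintype W]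
    [DecidableEq W] {H : SimpleGraph W} [DecidableRel H.Adj] {u' v' : W}
    (h' : H.IsBookWithLeaves u' v' a b) : Nonempty (G ≃g H) := by
  have e : ∀ i, {w // bookRole G u v w = i} ≃ {w // bookRole H u' v' w = i} := fun i =>
    Fintype.equivOfCardEq ((h.card_role i).trans (h'.card_role i).symm)
  have hmap := Equiv.ofFiberEquiv_map e
  refine ⟨⟨Equiv.ofFiberEquiv e, fun {y w} => ?_⟩⟩
  rw [h'.adj_iff, h.adj_iff, hmap, hmap]

/-- A lower bound for the largest eigenvalue from an explicit test vector. -/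
theorem IsBookWithLeaves.le_sq_sub (h : G.IsBookWithLeaves u v a b) {ρ : ℝ}
    (hray : ∀ y : V → ℝ, ∑ v, ∑ w, G.adjFun v w * (y v * y w) ≤ ρ * ∑ v, y v ^ 2) :
    1 ≤ ρ ∧ 2 * a + b / 2 ≤ ρ ^ 2 - ρ := by
  have huv := h.adj.ne
  have key : ∀ t p : ℝ, 2 + 4 * a * t + 2 * b * p ≤ ρ * (2 + a * t ^ 2 + b * p ^ 2) := by
    intro t p
    set R : Finset V := univ \ {u, v}
    have hmem : ∀ w, w ∈ R ↔ w ≠ u ∧ w ≠ v := fun w => by simp [R]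
    set z : V → ℝ := fun w => if w = u then 1 else if w = v then 1 else if G.Adj v w then t else p
    have hz : ∀ w ∈ R, z w = if G.Adj v w then t else p := fun w hw => by
      simp [z, ((hmem w).1 hw).1, ((hmem w).1 hw).2]
    have hzu : z u = 1 := by simp [z]
    have hzv : z v = 1 := by simp [z]
    have hsumR : ∀ c d : ℝ, ∑ w ∈ R, (if G.Adj v w then c else d) = a * c + b * d := fun c d => by
      rw [sum_ite, sum_const, sum_const, h.card_adj, h.card_not_adj, nsmul_eq_mul, nsmul_eq_mul]
    have h1 : ∑ w, z w ^ 2 = 2 + a * t ^ 2 + b * p ^ 2 := by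
      rw [← sum_sdiff (subset_univ {u, v}), sum_pair huv, hzu, hzv,
        sum_congr rfl fun w hw => by rw [hz w hw, ite_pow], hsumR]
      ring
    have h2 : ∑ y, ∑ w, G.adjFun y w * (z y * z w) = 2 + 4 * a * t + 2 * b * p := by
      rw [sum_sum_eq_of_symm (fun y w => by rw [G.adjFun_comm, mul_comm (z y)]) (fun y => by simp)
        huv, sum_eq_zero (s := R) fun y hy => sum_eq_zero fun w hw => by
          rw [G.adjFun_of_not_adj (h.not_adj y w ((hmem y).1 hy).1 ((hmem y).1 hy).2
            ((hmem w).1 hw).1 ((hmem w).1 hw).2), zero_mul]]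
      have : ∑ w ∈ R, (G.adjFun u w * (z u * z w) + G.adjFun v w * (z v * z w)) =
          ∑ w ∈ R, (if G.Adj v w then 2 * t else p) := sum_congr rfl fun w hw => by
        rw [hz w hw, G.adjFun_of_adj (h.adj_left w ((hmem w).1 hw).1), hzu, hzv]
        split_ifs with hvw
        · rw [G.adjFun_of_adj hvw]; ring
        · rw [G.adjFun_of_not_adj hvw]; ring
      rw [this, hsumR, G.adjFun_of_adj h.adj, hzu, hzv]
      ring
    rw [← h1, ← h2]
    exact hray z
  have hρ : 1 ≤ ρ := by linarith [key 0 0]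
  refine ⟨hρ, ?_⟩
  have hρ0 : 0 < ρ := by linarith
  -- These values of `t` and `p` make `key` sharpest: they maximise `4t - ρt²` and `2p - ρp²`.
  have h1 := mul_le_mul_of_nonneg_right (key (2 / ρ) (1 / ρ)) hρ0.le
  have e1 : (2 + 4 * a * (2 / ρ) + 2 * b * (1 / ρ)) * ρ = 2 * ρ + 8 * a + 2 * b := by
    field_simp; ring
  have e2 : ρ * (2 + a * (2 / ρ) ^ 2 + b * (1 / ρ) ^ 2) * ρ = 2 * ρ ^ 2 + 4 * a + b := by
    field_simp; ring
  rw [e1, e2] at h1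
  linarith

end

open Classical in
theorem isBookWithLeaves_extremalGraphOdd (m : ℕ) :
    (extremalGraphOdd m).IsBookWithLeaves (Sum.inl 0) (Sum.inl 1) ((m - 1) / 2) 0 := by
  have hR : (univ \ {Sum.inl 0, Sum.inl 1} : Finset (Fin 2 ⊕ Fin ((m - 1) / 2))) =
      univ.map Function.Embedding.inr := by
    ext w
    rcases w with i | i
    · fin_cases i <;> simp
    · simp
  have hadj : ∀ i, (extremalGraphOdd m).Adj (Sum.inl 1) (Sum.inr i) := fun i => by
    simp [extremalGraphOdd, graphJoin]
  refine ⟨by simp [extremalGraphOdd, graphJoin], ?_, ?_, ?_, ?_⟩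
  · rintro (i | i) hi
    · fin_cases i
      · exact absurd rfl hi
      · simp [extremalGraphOdd, graphJoin]
    · simp [extremalGraphOdd, graphJoin]
  · rintro (i | i) (j | j) h1 h2 h3 h4
    · fin_cases i
      · exact absurd rfl h1
      · exact absurd rfl h2
    · fin_cases i
      · exact absurd rfl h1
      · exact absurd rfl h2
    · fin_cases j
      · exact absurd rfl h3
      · exact absurd rfl h4
    · simp [extremalGraphOdd, graphJoin]
  · rw [hR, filter_true_of_mem fun w hw => ?_, card_map, card_univ, Fintype.card_fin]
    obtain ⟨i, -, rfl⟩ := mem_map.1 hw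
    exact hadj i
  · rw [hR, card_eq_zero, filter_eq_empty_iff]
    intro w hw
    obtain ⟨i, -, rfl⟩ := mem_map.1 hw
    exact not_not.2 (hadj i)

open Classical in
theorem isBookWithLeaves_extremalGraphEven (m : ℕ) :
    (extremalGraphEven m).IsBookWithLeaves (Sum.inl 0) (Sum.inr (Sum.inl 0)) ((m - 2) / 2) 1 := by
  have hadj : ∀ i : Fin ((m - 2) / 2), (extremalGraphEven m).Adj (Sum.inr (Sum.inl 0))
      (Sum.inr (Sum.inl i.succ)) := fun i => by
    simp [extremalGraphEven, graphJoin, starWithEdges, Fin.succ_ne_zero, (Fin.succ_ne_zero i).symm]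
  have hnadj : ∀ i, ¬ (extremalGraphEven m).Adj (Sum.inr (Sum.inl 0)) (Sum.inr (Sum.inr i)) :=
    fun i => by simp [extremalGraphEven, graphJoin]
  refine ⟨by simp [extremalGraphEven, graphJoin], ?_, ?_, ?_, ?_⟩
  · rintro (i | i) hi
    · exact absurd (by rw [Subsingleton.elim i 0]) hi
    · simp [extremalGraphEven, graphJoin]
  · rintro (i | i | i) (j | j | j) h1 h2 h3 h4
    all_goals first
      | exact absurd (congrArg Sum.inl (Subsingleton.elim i 0)) h1
      | exact absurd (congrArg Sum.inl (Subsingleton.elim j 0)) h3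
      | skip
    all_goals simp_all [extremalGraphEven, graphJoin, starWithEdges]
    exact Subsingleton.elim _ _
  · refine Eq.trans (congrArg card (?_ : _ = (univ : Finset (Fin ((m - 2) / 2))).image
      fun i => Sum.inr (Sum.inl i.succ)))
      (by rw [card_image_of_injective _ fun i j h => by simpa using h, card_univ, Fintype.card_fin])
    ext w
    rcases w with i | i | i
    · simp [Subsingleton.elim i 0]
    · refine Fin.cases ?_ (fun i => ?_) i
      · simp
      · simpa using hadj i
    · simpa using hnadj i
  · refine card_eq_one.2 ⟨Sum.inr (Sum.inr 0), ?_⟩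
    ext w
    rcases w with i | i | i
    · simp [Subsingleton.elim i 0]
    · refine Fin.cases ?_ (fun i => ?_) i
      · simp
      · simpa using hadj i
    · simpa [Subsingleton.elim i 0] using hnadj 0

end SimpleGraph

/-! ### Uniqueness, removal of isolated vertices, and the theorem. -/

theorem IsPlanarGraph.noThreeThree {V : Type*} [Fintype V] {G : SimpleGraph V}
    (hG : IsPlanarGraph G) : G.NoThreeThree := by
  classical
  obtain ⟨D⟩ := hG
  intro a b c hab hac hbc
  by_contra! h
  have hsum : ∑ t, G.adjFun a t * (G.adjFun b t * G.adjFun c t) =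
      #{t | G.Adj a t ∧ G.Adj b t ∧ G.Adj c t} := by
    rw [← sum_boole]
    refine sum_congr rfl fun t _ => ?_
    by_cases h1 : G.Adj a t <;> by_cases h2 : G.Adj b t <;> by_cases h3 : G.Adj c t <;>
      simp [adjFun, h1, h2, h3]
  rw [hsum] at h
  have h2 : 2 < #{t | G.Adj a t ∧ G.Adj b t ∧ G.Adj c t} := by exact_mod_cast h
  obtain ⟨x, hx, y, hy, z, hz, hxy, hxz, hyz⟩ := two_lt_card.1 h2
  simp only [mem_filter, mem_univ, true_and] at hx hy hz
  have inj : ∀ {p q r : V}, p ≠ q → p ≠ r → q ≠ r → Function.Injective ![p, q, r] := by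
    intro p q r h1 h2 h3 i j hij
    fin_cases i <;> fin_cases j <;> simp_all [eq_comm]
  refine D.no_three_three ![a, b, c] ![x, y, z] (inj hab hac hbc) (inj hxy hxz hyz) fun i j => ?_
  fin_cases i <;> fin_cases j <;> simp_all

namespace SimpleGraph

theorem sum_realDegree {V : Type*} [Fintype V] (G : SimpleGraph V) :
    ∑ v, G.realDegree v = 2 * (G.edgeSet.ncard : ℝ) := by
  classical
  have h := G.sum_degrees_eq_twice_card_edges
  rw [Set.ncard_eq_toFinset_card', ← edgeFinset]
  rw [← Nat.cast_ofNat, ← Nat.cast_mul, ← h, Nat.cast_sum]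
  refine sum_congr rfl fun v _ => ?_
  rw [realDegree, ← card_neighborFinset_eq_degree, neighborFinset_eq_filter, ← sum_boole]
  exact sum_congr rfl fun w _ => by simp [adjFun]

theorem graphSpectralRadius_le_of_iso {V W : Type*} [Fintype V] [Fintype W] {G : SimpleGraph V}
    {H : SimpleGraph W} (e : G ≃g H) : graphSpectralRadius G ≤ graphSpectralRadius H := by
  classical
  refine iSup₂_le fun k hk => ?_
  refine le_iSup₂ (f := fun k (_ : k ∈ spectrum ℝ (H.adjMatrix ℝ)) => (‖k‖₊ : ENNReal)) k ?_
  obtain ⟨y, ⟨v, hv⟩, hy⟩ := (mem_spectrum_adjMatrix_iff G k).1 hk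
  refine (mem_spectrum_adjMatrix_iff H k).2 ⟨y ∘ e.symm, ⟨e v, by simpa using hv⟩, fun w => ?_⟩
  rw [Function.comp_apply, hy, ← e.toEquiv.sum_comp]
  refine sum_congr rfl fun z _ => ?_
  have : G.Adj (e.symm w) z ↔ H.Adj w (e z) := by rw [← e.map_adj_iff, e.apply_symm_apply]
  simp [adjFun, this]

theorem graphSpectralRadius_eq_of_iso {V W : Type*} [Fintype V] [Fintype W] {G : SimpleGraph V}
    {H : SimpleGraph W} (e : G ≃g H) : graphSpectralRadius G = graphSpectralRadius H :=
  le_antisymm (graphSpectralRadius_le_of_iso e) (graphSpectralRadius_le_of_iso e.symm)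

theorem exists_isPerronVector {V : Type*} [Fintype V] [Nonempty V] (G : SimpleGraph V) :
    ∃ (ρ : ℝ) (x : V → ℝ) (u : V), G.IsPerronVector ρ x u ∧ 0 ≤ ρ ∧
      graphSpectralRadius G = ENNReal.ofReal ρ ∧
      ∀ y : V → ℝ, ∑ v, ∑ w, G.adjFun v w * (y v * y w) ≤ ρ * ∑ v, y v ^ 2 := by
  obtain ⟨ρ, x, hx, ⟨v, hv⟩, heig, hray⟩ := exists_perron_vector G
  obtain ⟨hρ, hG⟩ := graphSpectralRadius_eq_ofReal G hx ⟨v, hv⟩ heig hray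
  obtain ⟨u, -, hu⟩ := univ.exists_max_image x ⟨v, mem_univ v⟩
  have hpos : 0 < x u := (lt_of_le_of_ne (hx v) hv.symm).trans_le (hu v (mem_univ v))
  refine ⟨ρ, fun v => x v / x u, u, ⟨fun v => by have := hx v; positivity, fun v => ?_,
    div_self hpos.ne', fun v => ?_⟩, hρ, hG, hray⟩
  · exact (div_le_one hpos).2 (hu v (mem_univ v))
  · simp only [← mul_div_assoc, heig, sum_div]

/-- Among large graphs without isolated vertices and without `K₃,₃`, the book with at most one leaf
is the only one with the largest spectral radius. -/
theorem NoThreeThree.nonempty_iso_of_le :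
    ∃ M : ℕ, ∀ {V W : Type*} [Fintype V] [Fintype W] [DecidableEq W] {G : SimpleGraph V}
      {H : SimpleGraph W} [DecidableRel H.Adj], G.NoThreeThree → (∀ v, ¬ G.IsIsolated v) →
      ∀ {m a b : ℕ} {u v : W}, M ≤ m → ∑ v, G.realDegree v = 2 * (m : ℝ) → m = 1 + 2 * a + b →
      b ≤ 1 → H.IsBookWithLeaves u v a b → graphSpectralRadius H ≤ graphSpectralRadius G →
      Nonempty (G ≃g H) := by
  obtain ⟨M, hM⟩ := NoThreeThree.exists_structure
  refine ⟨max ⌈M⌉₊ 10, fun {V W} _ _ _ {G H} _ hG hiso {m a b u v} hm hsum hmab hb hH hle => ?_⟩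
  classical
  have hm10 : (10 : ℝ) ≤ m := by exact_mod_cast (le_max_right _ _).trans hm
  have hMm : M ≤ m := (Nat.le_ceil M).trans (by exact_mod_cast (le_max_left _ _).trans hm)
  have hmab' : (m : ℝ) = 1 + 2 * a + b := by exact_mod_cast hmab
  have hb' : (b : ℝ) ≤ 1 := by exact_mod_cast hb
  have : Nonempty W := ⟨u⟩
  have : Nonempty V := by
    by_contra h
    rw [not_nonempty_iff] at h
    rw [univ_eq_empty, sum_empty] at hsum
    linarith
  obtain ⟨ρ', -, -, -, hρ'0, hHρ', hray⟩ := exists_isPerronVector H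
  obtain ⟨ρ, x, u₁, hx, hρ0, hGρ, -⟩ := exists_isPerronVector G
  rw [hHρ', hGρ, ENNReal.ofReal_le_ofReal_iff hρ0] at hle
  obtain ⟨hρ'1, hlow⟩ := hH.le_sq_sub hray
  -- `t² - t` increases for `t ≥ 1`; the lower bound for `H` thus passes to `G` and gives deficit at
  -- most `1 + b/2`.
  have hsq : ρ' ^ 2 - ρ' ≤ ρ ^ 2 - ρ := by nlinarith
  have hρ2 : 2 ≤ ρ := by
    by_contra! h
    nlinarith
  obtain ⟨v₁, h1, h2, h3, h4, h5, h6⟩ := hM hG hiso hx hsum hMm hρ2 (by linarith)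
  set a₁ := #{w ∈ univ \ {u₁, v₁} | G.Adj v₁ w} with ha₁
  set b₁ := #{w ∈ univ \ {u₁, v₁} | ¬ G.Adj v₁ w} with hb₁
  have h4' : m = 1 + 2 * a₁ + b₁ := by exact_mod_cast h4
  -- For `b = 0` the deficit is at most `1`, which excludes leaves. For `b = 1` the number `m` is
  -- even, so `b₁ ≤ 2` is odd.
  have hbb : b₁ = b ∧ a₁ = a := by
    rcases Nat.le_one_iff_eq_zero_or_eq_one.1 hb with rfl | rfl
    · have := h6 (by
        push_cast at hmab' hlow
        linarith)
      omega
    · omega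
  have hbook : G.IsBookWithLeaves u₁ v₁ a b := ⟨h1, h2, h3, hbb.2, hbb.1⟩
  exact hbook.nonempty_iso hH

section support

theorem adjFun_induce {V : Type*} (G : SimpleGraph V) (s : Set V) (v w : s) : (G.induce s).adjFun v w = G.adjFun v w := by
  by_cases h : G.Adj v w
  · rw [G.adjFun_of_adj h, adjFun_of_adj _ (by exact h)]
  · rw [G.adjFun_of_not_adj h, adjFun_of_not_adj _ (by exact h)]

theorem not_isIsolated_induce_support {V : Type*} (G : SimpleGraph V) (v : G.support) :
    ¬ (G.induce G.support).IsIsolated v := by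
  intro h
  obtain ⟨w, hw⟩ := G.mem_support.1 v.2
  exact h ⟨w, G.mem_support.2 ⟨v, hw.symm⟩⟩ hw

variable {V : Type*} [Fintype V] (G : SimpleGraph V) [Fintype G.support]

theorem sum_support_eq {f : V → ℝ} (hf : ∀ v, G.IsIsolated v → f v = 0) :
    ∑ v : G.support, f v = ∑ v, f v := by
  rw [sum_set_coe]
  refine sum_subset (subset_univ _) fun v _ hv => hf v ?_
  rwa [Set.mem_toFinset, notMem_support_iff_isIsolated] at hv

theorem sum_adjFun_support (v : V) (f : V → ℝ) :
    ∑ w : G.support, G.adjFun v w * f w = ∑ w, G.adjFun v w * f w :=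
  G.sum_support_eq (f := fun w => G.adjFun v w * f w) fun w hw => by
    rw [G.adjFun_comm, G.adjFun_of_not_adj (hw v), zero_mul]

theorem sum_realDegree_induce_support :
    ∑ v, (G.induce G.support).realDegree v = ∑ v, G.realDegree v := by
  have h : ∀ v : G.support, (G.induce G.support).realDegree v = G.realDegree v := fun v => by
    have := G.sum_adjFun_support v fun _ => 1
    simpa [realDegree, adjFun_induce] using this
  simp only [h]
  refine G.sum_support_eq fun v hv => sum_eq_zero fun w _ => G.adjFun_of_not_adj (hv w)

variable {G}

theorem NoThreeThree.induce_support (hG : G.NoThreeThree) :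
    (G.induce G.support).NoThreeThree := by
  intro a b c hab hac hbc
  simp only [adjFun_induce]
  rw [G.sum_adjFun_support a fun t => G.adjFun b t * G.adjFun c t]
  exact hG _ _ _ (Subtype.coe_injective.ne hab) (Subtype.coe_injective.ne hac)
    (Subtype.coe_injective.ne hbc)

/-- An eigenvector for a nonzero eigenvalue vanishes at isolated vertices, so it restricts to the
support; the eigenvalue `0` does not affect the supremum. -/
theorem graphSpectralRadius_le_induce_support :
    graphSpectralRadius G ≤ graphSpectralRadius (G.induce G.support) := by
  classical
  refine iSup₂_le fun k hk => ?_
  by_cases hk0 : k = 0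
  · simp [hk0]
  have hdef : graphSpectralRadius (G.induce G.support) =
      ⨆ k ∈ spectrum ℝ ((G.induce G.support).adjMatrix ℝ), (‖k‖₊ : ENNReal) := by
    unfold graphSpectralRadius spectralRadius
    congr!
  rw [hdef]
  refine le_iSup₂ (f := fun k (_ : k ∈ spectrum ℝ ((G.induce G.support).adjMatrix ℝ)) =>
    (‖k‖₊ : ENNReal)) k ?_
  obtain ⟨y, ⟨v, hv⟩, hy⟩ := (mem_spectrum_adjMatrix_iff G k).1 hk
  have hvs : v ∈ G.support := by
    by_contra h
    have h' := G.notMem_support_iff_isIsolated.1 h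
    have := hy v
    rw [sum_eq_zero fun w _ => by rw [G.adjFun_of_not_adj (h' w), zero_mul]] at this
    exact (mul_ne_zero hk0 hv) this
  refine (mem_spectrum_adjMatrix_iff _ k).2 ⟨fun w => y w, ⟨⟨v, hvs⟩, hv⟩, fun w => ?_⟩
  simp only [adjFun_induce, G.sum_adjFun_support, hy]

end support

/-- The conclusion of the theorem from the uniqueness of the extremal graph. -/
theorem radius_le_and_eq_iff_of_forall_iso.{u, w} {V : Type u} {W : Type w} [Fintype V] [Fintype W]
    {G : SimpleGraph V} {H : SimpleGraph W} {m : ℕ} (hG : G.NoThreeThree)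
    (hm : ∑ v, G.realDegree v = 2 * (m : ℝ))
    (huniq : ∀ {V' : Type u} [Fintype V'] {G' : SimpleGraph V'}, G'.NoThreeThree →
      (∀ v, ¬ G'.IsIsolated v) → ∑ v, G'.realDegree v = 2 * (m : ℝ) →
      graphSpectralRadius H ≤ graphSpectralRadius G' → Nonempty (G' ≃g H)) :
    graphSpectralRadius G ≤ graphSpectralRadius H ∧
      ((∀ v, ¬ G.IsIsolated v) →
        (graphSpectralRadius G = graphSpectralRadius H ↔ Nonempty (G ≃g H))) := by
  classical
  constructor
  -- A graph beating `H` would, after deletion of its isolated vertices, be isomorphic to `H` by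
  -- uniqueness and so have the same radius.
  · by_contra! hlt
    have hle := hlt.trans_le (graphSpectralRadius_le_induce_support (G := G))
    obtain ⟨e⟩ := huniq hG.induce_support G.not_isIsolated_induce_support
      (G.sum_realDegree_induce_support.trans hm) hle.le
    exact hle.ne (graphSpectralRadius_eq_of_iso e).symm
  · exact fun hiso => ⟨fun h => huniq hG hiso hm h.ge, fun ⟨e⟩ => graphSpectralRadius_eq_of_iso e⟩

end SimpleGraph

theorem mainTheorem1 :
    ∃ M : ℕ, ∀ m : ℕ, M ≤ m →
      ∀ (V : Type*) [Fintype V] (G : SimpleGraph V), IsPlanarGraph G → G.edgeSet.ncard = m →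
        (Odd m →
          graphSpectralRadius G ≤ graphSpectralRadius (extremalGraphOdd m) ∧
          ((∀ v, ¬ G.IsIsolated v) →
            (graphSpectralRadius G = graphSpectralRadius (extremalGraphOdd m) ↔
              Nonempty (G ≃g extremalGraphOdd m)))) ∧
        (Even m →
          graphSpectralRadius G ≤ graphSpectralRadius (extremalGraphEven m) ∧
          ((∀ v, ¬ G.IsIsolated v) →
            (graphSpectralRadius G = graphSpectralRadius (extremalGraphEven m) ↔
              Nonempty (G ≃g extremalGraphEven m)))) := by
  classical
  obtain ⟨M, hM⟩ := NoThreeThree.nonempty_iso_of_le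
  -- The bound `2` keeps the truncated subtraction in `(m - 2) / 2` exact for even `m`.
  refine ⟨max M 2, fun m hm V _ G hplanar hcard => ?_⟩
  have hmM := (le_max_left _ _).trans hm
  have hm2 := (le_max_right _ _).trans hm
  have hsum : ∑ v, G.realDegree v = 2 * (m : ℝ) := by rw [G.sum_realDegree, hcard]
  refine ⟨fun hodd => ?_, fun heven => ?_⟩
  · refine radius_le_and_eq_iff_of_forall_iso hplanar.noThreeThree hsum
      fun hG' hiso hsum' hle => hM hG' hiso hmM hsum' ?_ zero_le_one
        (isBookWithLeaves_extremalGraphOdd m) hle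
    obtain ⟨k, rfl⟩ := hodd
    omega
  · refine radius_le_and_eq_iff_of_forall_iso hplanar.noThreeThree hsum
      fun hG' hiso hsum' hle => hM hG' hiso hmM hsum' ?_ le_rfl
        (isBookWithLeaves_extremalGraphEven m) hle
    obtain ⟨k, rfl⟩ := heven
    omega
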